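/- An overpartition of $n$ is a nonincreasing sequence of positive integers with sum $n$ in which the first occurrence of each number may be overlined. It is an odd-even overpartition if its smallest part is odd and the difference between successive parts is odd if the smaller one is nonoverlined and even otherwise. Let $\overline{OE}(n)$ be the number of odd-even overpartitions of $n$, with $\overline{OE}(0)=1$, and let $$\overline{\mathscr O}(q)=\sum_{n\ge 0}\overline{OE}(n)q^n ,$$ a series which converges for $|q|<1$. Write $q=e^{2\pi i\tau}$ with $\tau=x+iy$, $x\in\mathbb R$, $y>0$. Theorem. Fix $M>0$. As $y\to0^+$, with implied constants depending only on $M$ (in particular, uniformly in $x$): (i) for $|x|\le My$, $$\overline{\mathscr O}(q)=\frac{2\sqrt2}{3}\,e^{\frac{\pi i}{24\tau}}+O\left(y\,e^{\frac{\pi}{24}\operatorname{Im}\left(\frac{-1}{\tau}\right)}\right);$$ (ii) for $My<|x|\le \frac12$, $$\overline{\mathscr O}(q)\ll\frac{1}{y\sqrt2}\exp\left[\frac1y\left(\frac{\pi}{8}-\frac1\pi\left(1-\frac{1}{\sqrt{1+M^2}}\right)\right)\right].$$ -/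

import Mathlib

namespace OddEvenOverpartition

/-- An overpartition of `n`, written as the list of its parts in nonincreasing order. An entry
`(k, b)` is a part of size `k`, overlined if and only if `b = true`. Only the first occurrence
of a number may be overlined. -/
def IsOverpartition (n : ℕ) (l : List (ℕ × Bool)) : Prop :=
  (∀ p ∈ l, 0 < p.1) ∧
  l.IsChain (fun a b => b.1 ≤ a.1 ∧ (b.2 = true → b.1 ≠ a.1)) ∧
  (l.map Prod.fst).sum = n

/-- The smallest part (if any) is odd, and the difference between successive parts is odd if the
smaller one is nonoverlined and even otherwise. The parts are listed in nonincreasing order. -/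
def IsOddEven (l : List (ℕ × Bool)) : Prop :=
  (∀ p ∈ l.getLast?, Odd p.1) ∧
  l.IsChain (fun a b => (b.2 = false → Odd (a.1 - b.1)) ∧ (b.2 = true → Even (a.1 - b.1)))

/-- The number of odd-even overpartitions of `n`. For `n = 0` only the empty list qualifies, so
the value is `1`. -/
noncomputable def count (n : ℕ) : ℕ :=
  {l : List (ℕ × Bool) | IsOverpartition n l ∧ IsOddEven l}.ncard

/-- The generating function of odd-even overpartitions. -/
noncomputable def genFun (q : ℂ) : ℂ :=
  ∑' n : ℕ, (count n : ℂ) * q ^ n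

/-- `q = exp (2 π i τ)`. -/
noncomputable def nome (τ : ℂ) : ℂ :=
  Complex.exp (2 * Real.pi * Complex.I * τ)

end OddEvenOverpartition

open Filter Topology Finset

/-! The conditions force the parts to be distinct, and every overline except that of the largest
part is dictated by the parity of a gap. Peeling off smallest parts (`hasSum_oddChains`) gives the
generating function as ∑ (-1;q)_n q^{n(n+1)/2} / (q²;q²)_n.

For (i), this series is turned into an Appell sum by a special case of Bailey's lemma: 1/(q²;q²)_n
is expanded by Gauss's alternating sum (`tsum_qInv_mul_qInv`), the sums are interchanged, and the
inner one is evaluated by a limiting q-Gauss sum (`tsum_gaussTerm`). The result (`tsum_eq_appell`)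
is (-q)_∞/(q)_∞ times a sum which, with w = -2πiτ, reads ∑_r (-1)^r e^{-3wr²/2} / cosh(wr/2).
Poisson summation makes it a sum of integrals with odd frequencies. The contour is moved to the
saddle πi/(3w) of frequency 1, which lies before the first pole πi/w. Frequencies 1 and -1 dominate
and give (4/√3) (2π/(3w))^{1/2} e^{-π²/(6w)} (`exists_tsum_kernel_eq`). The prefactor is
η(2τ)/η(τ)², and the inversion of η makes it asymptotic to (τ/(2i))^{1/2} e^{πi/(8τ)}. The exponents
combine as 1/8 - 1/12 = 1/24 and the constants as 4/(3√2) = 2√2/3.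

For (ii), each summand of the first series is bounded in absolute value. In log 1/|(q;q)_n| only the
linear terms ∑ q^k keep their phase; this geometric sum is at most 2/|1-q|, which is the saving away
from x = 0. All higher terms are replaced by their absolute values, and a one-variable inequality
(`quadratic_cubic_bound`) leaves a margin in the exponent that absorbs every power of 1/y. -/

namespace OddEvenOverpartition

/-! ### q-Pochhammer symbols: uniform bounds, convergence, nonvanishing. -/

/-- The finite `q`-Pochhammer symbol `(a; q)_n`. -/
def qPoch (a q : ℂ) (n : ℕ) : ℂ := ∏ k ∈ range n, (1 - a * q ^ k)

/-- The infinite `q`-Pochhammer symbol `(a; q)_∞`. -/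
noncomputable def qPochInf (a q : ℂ) : ℂ := ∏' k : ℕ, (1 - a * q ^ k)

@[simp] lemma qPoch_zero (a q : ℂ) : qPoch a q 0 = 1 := by simp [qPoch]

lemma qPoch_succ (a q : ℂ) (n : ℕ) : qPoch a q (n + 1) = qPoch a q n * (1 - a * q ^ n) := by
  simp [qPoch, prod_range_succ]

lemma qPoch_add (a q : ℂ) (m n : ℕ) :
    qPoch a q (m + n) = qPoch a q m * qPoch (a * q ^ m) q n := by
  simp [qPoch, prod_range_add, pow_add, mul_assoc]

lemma qPoch_succ' (a q : ℂ) (n : ℕ) : qPoch a q (n + 1) = (1 - a) * qPoch (a * q) q n := by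
  rw [add_comm, qPoch_add]; simp [qPoch]

lemma sum_pow_le_inv {r : ℝ} (h0 : 0 ≤ r) (h1 : r < 1) (n : ℕ) :
    ∑ k ∈ range n, r ^ k ≤ (1 - r)⁻¹ := by
  rw [← tsum_geometric_of_lt_one h0 h1]
  exact (summable_geometric_of_lt_one h0 h1).sum_le_tsum _ (fun i _ => by positivity)

lemma norm_qPoch_le {a q : ℂ} (hq : ‖q‖ < 1) (n : ℕ) :
    ‖qPoch a q n‖ ≤ Real.exp (‖a‖ * (1 - ‖q‖)⁻¹) := by
  rw [qPoch, norm_prod]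
  calc ∏ k ∈ range n, ‖1 - a * q ^ k‖ ≤ ∏ k ∈ range n, Real.exp (‖a‖ * ‖q‖ ^ k) := by
        refine prod_le_prod (fun _ _ => norm_nonneg _) fun k _ => ?_
        calc ‖1 - a * q ^ k‖ ≤ ‖(1 : ℂ)‖ + ‖a * q ^ k‖ := norm_sub_le _ _
          _ = ‖a‖ * ‖q‖ ^ k + 1 := by simp [add_comm]
          _ ≤ _ := Real.add_one_le_exp _
    _ = Real.exp (‖a‖ * ∑ k ∈ range n, ‖q‖ ^ k) := by rw [← Real.exp_sum, mul_sum]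
    _ ≤ _ := by
        gcongr
        exact sum_pow_le_inv (norm_nonneg _) hq n

lemma one_sub_mul_pow_ne_zero {a q : ℂ} (ha : ‖a‖ < 1) (hq : ‖q‖ < 1) (k : ℕ) :
    1 - a * q ^ k ≠ 0 := by
  intro h
  have h1 : ‖a * q ^ k‖ = 1 := by rw [← sub_eq_zero.mp h]; simp
  rw [norm_mul, norm_pow] at h1
  have := mul_le_of_le_one_right (norm_nonneg a) (pow_le_one₀ (n := k) (norm_nonneg q) hq.le)
  linarith

lemma qPoch_ne_zero {a q : ℂ} (ha : ‖a‖ < 1) (hq : ‖q‖ < 1) (n : ℕ) : qPoch a q n ≠ 0 :=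
  prod_ne_zero_iff.mpr fun k _ => one_sub_mul_pow_ne_zero ha hq k

/-- Uniformity in n and over the disc ‖a‖ ≤ ρ supplies the dominating series below, and keeps the
infinite product away from 0. -/
lemma norm_qPoch_inv_le {a q : ℂ} {ρ : ℝ} (ha : ‖a‖ ≤ ρ) (hρ : ρ < 1) (hq : ‖q‖ < 1) (n : ℕ) :
    ‖(qPoch a q n)⁻¹‖ ≤ Real.exp (ρ / (1 - ρ) * (1 - ‖q‖)⁻¹) := by
  have hρ0 : 0 ≤ ρ := (norm_nonneg a).trans ha
  rw [qPoch, ← prod_inv_distrib, norm_prod]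
  calc ∏ k ∈ range n, ‖(1 - a * q ^ k)⁻¹‖
      ≤ ∏ k ∈ range n, Real.exp (ρ / (1 - ρ) * ‖q‖ ^ k) := by
        refine prod_le_prod (fun _ _ => norm_nonneg _) fun k _ => ?_
        have hpk : ‖q‖ ^ k ≤ 1 := pow_le_one₀ (norm_nonneg q) hq.le
        have hpk0 : 0 ≤ ‖q‖ ^ k := by positivity
        have h2 : ‖a * q ^ k‖ ≤ ρ * ‖q‖ ^ k := by
          rw [norm_mul, norm_pow]; gcongr
        have h3 : ρ * ‖q‖ ^ k ≤ ρ := mul_le_of_le_one_right hρ0 hpk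
        have h1 : 1 - ρ * ‖q‖ ^ k ≤ ‖1 - a * q ^ k‖ := by
          have := norm_sub_norm_le (1 : ℂ) (a * q ^ k)
          rw [norm_one] at this
          linarith
        have h4 : 0 < 1 - ρ * ‖q‖ ^ k := by linarith
        rw [norm_inv]
        calc ‖1 - a * q ^ k‖⁻¹ ≤ (1 - ρ * ‖q‖ ^ k)⁻¹ := inv_anti₀ h4 h1
          _ = ρ * ‖q‖ ^ k / (1 - ρ * ‖q‖ ^ k) + 1 := by field_simp; ring
          _ ≤ ρ * ‖q‖ ^ k / (1 - ρ) + 1 := by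
              have : 0 < 1 - ρ := by linarith
              gcongr
          _ = ρ / (1 - ρ) * ‖q‖ ^ k + 1 := by ring
          _ ≤ _ := Real.add_one_le_exp _
    _ = Real.exp (ρ / (1 - ρ) * ∑ k ∈ range n, ‖q‖ ^ k) := by rw [← Real.exp_sum, mul_sum]
    _ ≤ _ := by
        have : 0 ≤ ρ / (1 - ρ) := div_nonneg hρ0 (by linarith)
        gcongr
        exact sum_pow_le_inv (norm_nonneg _) hq n

lemma multipliable_qPoch (a : ℂ) {q : ℂ} (hq : ‖q‖ < 1) :
    Multipliable fun k : ℕ => 1 - a * q ^ k := by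
  have : Multipliable fun k : ℕ => 1 + (-(a * q ^ k)) := by
    apply multipliable_one_add_of_summable
    simpa using (summable_geometric_of_lt_one (norm_nonneg _) hq).mul_left ‖a‖
  simpa [sub_eq_add_neg] using this

lemma tendsto_qPoch (a : ℂ) {q : ℂ} (hq : ‖q‖ < 1) :
    Tendsto (qPoch a q) atTop (𝓝 (qPochInf a q)) :=
  (multipliable_qPoch a hq).hasProd.tendsto_prod_nat

lemma qPochInf_ne_zero {a q : ℂ} (ha : ‖a‖ < 1) (hq : ‖q‖ < 1) : qPochInf a q ≠ 0 := by
  have h1 : ∀ n, (Real.exp (‖a‖ / (1 - ‖a‖) * (1 - ‖q‖)⁻¹))⁻¹ ≤ ‖qPoch a q n‖ := fun n => by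
    have h := norm_qPoch_inv_le le_rfl ha hq n
    rw [norm_inv] at h
    exact inv_le_of_inv_le₀ (norm_pos_iff.mpr (qPoch_ne_zero ha hq n)) h
  have := ge_of_tendsto (tendsto_qPoch a hq).norm (Eventually.of_forall h1)
  intro h
  rw [h, norm_zero] at this
  exact absurd this (not_le.mpr (inv_pos.mpr (Real.exp_pos _)))

lemma qPochInf_eq_mul (a : ℂ) {q : ℂ} (hq : ‖q‖ < 1) (n : ℕ) :
    qPochInf a q = qPoch a q n * qPochInf (a * q ^ n) q := by
  refine tendsto_nhds_unique ((tendsto_qPoch a hq).comp (tendsto_add_atTop_nat n)) ?_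
  have := (tendsto_qPoch (a * q ^ n) hq).const_mul (qPoch a q n)
  refine this.congr fun k => ?_
  simp [← qPoch_add, add_comm]

lemma qPoch_neg_mul (q : ℂ) (n : ℕ) : qPoch (-q) q n * qPoch q q n = qPoch (q ^ 2) (q ^ 2) n := by
  simp only [qPoch, ← prod_mul_distrib]
  refine prod_congr rfl fun k _ => ?_
  ring

lemma qPochInf_neg_mul {q : ℂ} (hq : ‖q‖ < 1) :
    qPochInf (-q) q * qPochInf q q = qPochInf (q ^ 2) (q ^ 2) := by
  have hq2 : ‖q ^ 2‖ < 1 := by rw [norm_pow]; exact pow_lt_one₀ (norm_nonneg _) hq two_ne_zero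
  refine tendsto_nhds_unique ((tendsto_qPoch _ hq).mul (tendsto_qPoch _ hq)) ?_
  exact (tendsto_qPoch _ hq2).congr fun n => (qPoch_neg_mul q n).symm

/-! ### A limiting case of the `q`-Gauss sum -/

/-- The general term of the limiting `q`-Gauss sum. -/
noncomputable def gaussTerm (q A x : ℂ) (k : ℕ) : ℂ :=
  qPoch A q k * (-x) ^ k * q ^ (k.choose 2) * ((qPoch q q k)⁻¹ * (qPoch (A * x) q k)⁻¹)

lemma norm_gaussTerm_le {q A x : ℂ} {ρ σ : ℝ} (hq : ‖q‖ < 1) (hx : ‖x‖ ≤ σ) (hAx : ‖A * x‖ ≤ ρ)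
    (hρ : ρ < 1) (k : ℕ) :
    ‖gaussTerm q A x k‖ ≤ Real.exp (‖A‖ * (1 - ‖q‖)⁻¹) * Real.exp (‖q‖ / (1 - ‖q‖) * (1 - ‖q‖)⁻¹) *
      Real.exp (ρ / (1 - ρ) * (1 - ‖q‖)⁻¹) * σ ^ k := by
  rw [gaussTerm]
  simp only [norm_mul, norm_pow, norm_neg]
  have h1 := norm_qPoch_le (a := A) hq k
  have h2 := norm_qPoch_inv_le (a := q) le_rfl hq hq k
  have h3 := norm_qPoch_inv_le hAx hρ hq k
  have h4 : ‖q‖ ^ k.choose 2 ≤ 1 := pow_le_one₀ (norm_nonneg _) hq.le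
  have hσ : 0 ≤ σ := (norm_nonneg x).trans hx
  calc _ ≤ Real.exp (‖A‖ * (1 - ‖q‖)⁻¹) * σ ^ k * 1 *
      (Real.exp (‖q‖ / (1 - ‖q‖) * (1 - ‖q‖)⁻¹) * Real.exp (ρ / (1 - ρ) * (1 - ‖q‖)⁻¹)) := by
        gcongr
    _ = _ := by ring

lemma summable_gaussTerm {q A x : ℂ} (hq : ‖q‖ < 1) (hx : ‖x‖ < 1) (hAx : ‖A * x‖ < 1) :
    Summable (gaussTerm q A x) :=
  Summable.of_norm_bounded ((summable_geometric_of_lt_one (norm_nonneg _) hx).mul_left _)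
    (norm_gaussTerm_le hq le_rfl le_rfl hAx)

/-- A telescoping certificate: summed over k, it proves the q-difference equation (1 - Ax) F(x) = (1
- x) F(xq) for the sum F of the series. -/
lemma gaussTerm_shift {q A x : ℂ} (hq : ‖q‖ < 1) (hAx : ‖A * x‖ < 1) (k : ℕ) :
    (1 - A * x) * gaussTerm q A x k - (1 - x) * gaussTerm q A (x * q) k =
      (1 - A * x) * (gaussTerm q A x k * (1 - q ^ k) -
        gaussTerm q A x (k + 1) * (1 - q ^ (k + 1))) := by
  have e1 := qPoch_succ (A * x) q k
  have e2 := qPoch_succ' (A * x) q k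
  have e3 := qPoch_succ q q k
  have e4 := qPoch_succ A q k
  have n1 := qPoch_ne_zero hAx hq k
  have n2 := qPoch_ne_zero hAx hq (k + 1)
  have n3 := qPoch_ne_zero hq hq k
  have n4 := qPoch_ne_zero hq hq (k + 1)
  have n5 := one_sub_mul_pow_ne_zero hAx hq k
  have n6 := one_sub_mul_pow_ne_zero hAx hq 0
  have n7 := one_sub_mul_pow_ne_zero hq hq k
  have e5 : (k + 1).choose 2 = k + k.choose 2 := by
    rw [Nat.choose_succ_succ]; simp
  have hB : (qPoch (A * x * q) q k)⁻¹ =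
      (1 - A * x) * ((qPoch (A * x) q k)⁻¹ * (1 - A * x * q ^ k)⁻¹) := by
    rw [pow_zero, mul_one] at n6
    rw [← mul_inv, ← e1, e2, mul_inv, ← mul_assoc, mul_inv_cancel₀ n6, one_mul]
  simp only [gaussTerm, e5, e1, e3, e4, ← mul_assoc A x q, hB, mul_inv]
  have h7 : (1 - q * q ^ k)⁻¹ * (1 - q ^ (k + 1)) = 1 := by
    rw [pow_succ']; exact inv_mul_cancel₀ n7
  generalize (qPoch q q k)⁻¹ = U
  generalize (qPoch (A * x) q k)⁻¹ = V
  generalize qPoch A q k = Y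
  have h8 : (1 - A * x * q ^ k) * (1 - A * x * q ^ k)⁻¹ = 1 := mul_inv_cancel₀ n5
  generalize (1 - q * q ^ k)⁻¹ = R at *
  generalize (1 - A * x * q ^ k)⁻¹ = S at *
  have h9 : (-(x * q)) ^ k = (-x) ^ k * q ^ k := by rw [← mul_pow]; ring
  rw [h9, pow_add q, pow_succ (-x)]
  generalize (-x) ^ k = X
  generalize q ^ (k.choose 2) = T
  generalize q ^ k = Q at *
  generalize q ^ (k + 1) = Q' at *
  linear_combination (-(1 - A * x) * Y * X * x * T * U * V * Q * (1 - A * Q) * S) * h7 -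
    ((1 - A * x) * Y * X * T * U * V * Q) * h8

lemma tsum_gaussTerm_shift {q A x : ℂ} (hq : ‖q‖ < 1) (hx : ‖x‖ < 1) (hAx : ‖A * x‖ < 1) :
    (1 - A * x) * ∑' k, gaussTerm q A x k = (1 - x) * ∑' k, gaussTerm q A (x * q) k := by
  have hs := summable_gaussTerm hq hx hAx
  have hs' : Summable (gaussTerm q A (x * q)) := by
    refine summable_gaussTerm hq ?_ ?_
    · rw [norm_mul]; exact mul_lt_one_of_nonneg_of_lt_one_left (norm_nonneg _) hx hq.le
    · rw [← mul_assoc, norm_mul]; exact mul_lt_one_of_nonneg_of_lt_one_left (norm_nonneg _) hAx hq.le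
  have key : ∑' k, ((1 - A * x) * gaussTerm q A x k - (1 - x) * gaussTerm q A (x * q) k) = 0 := by
    have hsum : Summable
        (fun k => (1 - A * x) * gaussTerm q A x k - (1 - x) * gaussTerm q A (x * q) k) :=
      (hs.mul_left _).sub (hs'.mul_left _)
    refine tendsto_nhds_unique hsum.hasSum.tendsto_sum_nat ?_
    have h0 : Tendsto (fun n => (1 - A * x) * (0 - gaussTerm q A x n * (1 - q ^ n))) atTop
        (𝓝 ((1 - A * x) * (0 - 0 * (1 - 0)))) :=
      ((hs.tendsto_atTop_zero.mul
        ((tendsto_pow_atTop_nhds_zero_of_norm_lt_one hq).const_sub 1)).const_sub 0).const_mul _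
    simp only [zero_mul, sub_zero, mul_zero] at h0
    refine h0.congr fun n => ?_
    simp only [gaussTerm_shift hq hAx, ← mul_sum]
    -- Only the upper boundary term survives, since the lower one carries the factor 1 - q^0 = 0.
    rw [sum_range_sub']
    simp
  rw [Summable.tsum_sub (hs.mul_left _) (hs'.mul_left _), tsum_mul_left, tsum_mul_left] at key
  exact sub_eq_zero.mp key

lemma tsum_gaussTerm_iterate {q A x : ℂ} (hq : ‖q‖ < 1) (hx : ‖x‖ < 1) (hAx : ‖A * x‖ < 1)
    (N : ℕ) :
    qPoch (A * x) q N * ∑' k, gaussTerm q A x k =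
      qPoch x q N * ∑' k, gaussTerm q A (x * q ^ N) k := by
  induction N with
  | zero => simp
  | succ N ih =>
    have hqN : ‖q ^ N‖ ≤ 1 := by rw [norm_pow]; exact pow_le_one₀ (norm_nonneg _) hq.le
    have h1 : ‖x * q ^ N‖ < 1 := by
      rw [norm_mul]; exact mul_lt_one_of_nonneg_of_lt_one_left (norm_nonneg _) hx hqN
    have h2 : ‖A * (x * q ^ N)‖ < 1 := by
      rw [← mul_assoc, norm_mul]
      exact mul_lt_one_of_nonneg_of_lt_one_left (norm_nonneg _) hAx hqN
    have := tsum_gaussTerm_shift hq h1 h2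
    rw [qPoch_succ, qPoch_succ, mul_right_comm, ih, pow_succ, ← mul_assoc x, mul_assoc _ (1 - _),
      ← this]
    ring

/-- The limiting case `∑ (A)_k (-x)^k q^{k(k-1)/2} / ((q)_k (Ax)_k) = (x)_∞ / (Ax)_∞` of the
`q`-Gauss sum. -/
lemma tsum_gaussTerm {q A x : ℂ} (hq : ‖q‖ < 1) (hx : ‖x‖ < 1) (hAx : ‖A * x‖ < 1) :
    qPochInf (A * x) q * ∑' k, gaussTerm q A x k = qPochInf x q := by
  -- Iterating the q-difference equation drives the argument to 0, where only the term k = 0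
  -- remains.
  have hlim : Tendsto (fun N : ℕ => ∑' k, gaussTerm q A (x * q ^ N) k) atTop (𝓝 1) := by
    have hq0 := tendsto_pow_atTop_nhds_zero_of_norm_lt_one hq
    have hxq : Tendsto (fun N : ℕ => x * q ^ N) atTop (𝓝 0) := by simpa using hq0.const_mul x
    have h0 : ∑' k, gaussTerm q A 0 k = 1 := by
      rw [tsum_eq_single 0]
      · simp [gaussTerm]
      · intro k hk; simp [gaussTerm, hk]
    rw [← h0]
    refine tendsto_tsum_of_dominated_convergence
      ((summable_geometric_of_lt_one (norm_nonneg _) hx).mul_left _) (fun k => ?_)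
      (Eventually.of_forall fun N k => norm_gaussTerm_le (ρ := ‖A * x‖) (σ := ‖x‖) hq ?_ ?_ hAx k)
    · have hc : ContinuousAt (fun z => gaussTerm q A z k) 0 := by
        have h1 : Continuous fun z => qPoch (A * z) q k := by
          unfold qPoch; fun_prop
        unfold gaussTerm
        have h2 : ContinuousAt (fun z => (qPoch (A * z) q k)⁻¹) 0 :=
          h1.continuousAt.inv₀ (by simp [qPoch])
        fun_prop
      exact hc.tendsto.comp hxq
    · rw [norm_mul, norm_pow]
      exact mul_le_of_le_one_right (norm_nonneg _) (pow_le_one₀ (norm_nonneg _) hq.le)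
    · rw [← mul_assoc, norm_mul, norm_pow]
      exact mul_le_of_le_one_right (norm_nonneg _) (pow_le_one₀ (norm_nonneg _) hq.le)
  have h1 := (tendsto_qPoch (A * x) hq).mul_const (∑' k, gaussTerm q A x k)
  have h2 := (tendsto_qPoch x hq).mul hlim
  rw [mul_one] at h2
  refine tendsto_nhds_unique h1 (h2.congr fun N => ?_)
  exact (tsum_gaussTerm_iterate hq hx hAx N).symm

end OddEvenOverpartition

namespace OddEvenOverpartition

/-! ### Gauss's evaluation of an alternating sum of `q`-binomial coefficients -/

/-- The alternating sum of `q⁻¹`-binomial coefficients, divided by `(q; q)_N`. -/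
noncomputable def altSum (q : ℂ) (N : ℕ) : ℂ :=
  ∑ p ∈ antidiagonal N,
    (-1) ^ p.2 * (q⁻¹) ^ (p.1 * p.2) * ((qPoch q q p.1)⁻¹ * (qPoch q q p.2)⁻¹)

lemma qPoch_inv_succ_mul {q : ℂ} (hq : ‖q‖ < 1) (n : ℕ) :
    (qPoch q q (n + 1))⁻¹ * (1 - q ^ (n + 1)) = (qPoch q q n)⁻¹ := by
  have h := one_sub_mul_pow_ne_zero hq hq n
  rw [qPoch_succ, mul_inv, pow_succ', mul_assoc, inv_mul_cancel₀ h, mul_one]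

/-- Write 1 - q^{i+j} = (1 - q^i) + q^i (1 - q^j): each piece cancels the last factor of one
Pochhammer symbol. After reindexing, the two pieces combine with the factor q^{-j} - 1, which
cancels one more factor and lowers the degree by two in all. -/
lemma altSum_add_two {q : ℂ} (hq : ‖q‖ < 1) (hq0 : q ≠ 0) (M : ℕ) :
    (1 - q ^ (M + 2)) * altSum q (M + 2) = -(q⁻¹) ^ (M + 1) * altSum q M := by
  set J : ℕ → ℂ := fun n => (qPoch q q n)⁻¹ with hJ
  have hJs : ∀ n, J (n + 1) * (1 - q ^ (n + 1)) = J n := qPoch_inv_succ_mul hq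
  have hqi : q * q⁻¹ = 1 := mul_inv_cancel₀ hq0
  have hqk : ∀ k : ℕ, q ^ k * q⁻¹ ^ k = 1 := fun k => by rw [← mul_pow, hqi, one_pow]
  have h1 : (1 - q ^ (M + 2)) * altSum q (M + 2) =
      (∑ p ∈ antidiagonal (M + 1 + 1),
        (-1) ^ p.2 * (q⁻¹) ^ (p.1 * p.2) * (J p.1 * J p.2) * (1 - q ^ p.1)) +
      ∑ p ∈ antidiagonal (M + 1 + 1),
        (-1) ^ p.2 * (q⁻¹) ^ (p.1 * p.2) * (J p.1 * J p.2) * (q ^ p.1 * (1 - q ^ p.2)) := by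
    rw [altSum, mul_sum, ← sum_add_distrib]
    refine sum_congr rfl fun p hp => ?_
    rw [HasAntidiagonal.mem_antidiagonal] at hp
    rw [show M + 2 = p.1 + p.2 by lia, pow_add]
    ring
  rw [h1, Finset.Nat.sum_antidiagonal_succ (n := M + 1),
    Finset.Nat.sum_antidiagonal_succ' (n := M + 1)]
  simp only [pow_zero, sub_self, mul_zero, zero_add]
  rw [← sum_add_distrib]
  have h2 : ∀ p ∈ antidiagonal (M + 1),
      (-1) ^ p.2 * q⁻¹ ^ ((p.1 + 1) * p.2) * (J (p.1 + 1) * J p.2) * (1 - q ^ (p.1 + 1)) +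
        (-1) ^ (p.2 + 1) * q⁻¹ ^ (p.1 * (p.2 + 1)) * (J p.1 * J (p.2 + 1)) *
          (q ^ p.1 * (1 - q ^ (p.2 + 1))) =
      (-1) ^ p.2 * q⁻¹ ^ (p.1 * p.2) * (q⁻¹ ^ p.2 - 1) * (J p.1 * J p.2) := by
    intro p _
    have e1 : q⁻¹ ^ ((p.1 + 1) * p.2) = q⁻¹ ^ (p.1 * p.2) * q⁻¹ ^ p.2 := by
      rw [← pow_add]; ring_nf
    have e2 : q⁻¹ ^ (p.1 * (p.2 + 1)) = q⁻¹ ^ (p.1 * p.2) * q⁻¹ ^ p.1 := by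
      rw [← pow_add]; ring_nf
    rw [e1, e2, pow_succ (-1 : ℂ)]
    linear_combination ((-1) ^ p.2 * q⁻¹ ^ (p.1 * p.2) * q⁻¹ ^ p.2 * J p.2) * hJs p.1 -
      ((-1) ^ p.2 * q⁻¹ ^ (p.1 * p.2) * J p.1 * J p.2) * hqk p.1 -
      ((-1) ^ p.2 * q⁻¹ ^ (p.1 * p.2) * J p.1 * (q ^ p.1 * q⁻¹ ^ p.1)) * hJs p.2
  rw [sum_congr rfl h2, Finset.Nat.sum_antidiagonal_succ', altSum, mul_sum]
  simp only [pow_zero, sub_self, mul_zero, zero_mul, zero_add]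
  refine sum_congr rfl fun p hp => ?_
  rw [HasAntidiagonal.mem_antidiagonal] at hp
  have e1 : q⁻¹ ^ (p.1 * (p.2 + 1)) = q⁻¹ ^ (p.1 * p.2) * q⁻¹ ^ p.1 := by
    rw [← pow_add]; ring_nf
  rw [e1, ← hp, pow_succ (-1 : ℂ), show p.1 + p.2 + 1 = p.1 + (p.2 + 1) by ring, pow_add q⁻¹ p.1]
  linear_combination (-(-1) ^ p.2 * q⁻¹ ^ (p.1 * p.2) * q⁻¹ ^ p.1 * q⁻¹ ^ (p.2 + 1) * J p.1) *
    hJs p.2 - ((-1) ^ p.2 * q⁻¹ ^ (p.1 * p.2) * q⁻¹ ^ p.1 * J p.1 * J (p.2 + 1)) * hqk (p.2 + 1)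

lemma altSum_two_mul {q : ℂ} (hq : ‖q‖ < 1) (hq0 : q ≠ 0) (n : ℕ) :
    altSum q (2 * n) = (-1) ^ n * (q⁻¹) ^ (n ^ 2) * (qPoch (q ^ 2) (q ^ 2) n)⁻¹ := by
  have hq2 : ‖q ^ 2‖ < 1 := by rw [norm_pow]; exact pow_lt_one₀ (norm_nonneg _) hq two_ne_zero
  induction n with
  | zero => simp [altSum]
  | succ n ih =>
    have h := altSum_add_two hq hq0 (2 * n)
    have h2 := qPoch_inv_succ_mul hq2 n
    have hne := one_sub_mul_pow_ne_zero hq2 hq2 n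
    rw [← pow_succ', ← pow_mul] at hne
    rw [← pow_mul] at h2
    rw [show 2 * (n + 1) = 2 * n + 2 by ring] at *
    refine mul_left_cancel₀ hne ?_
    rw [h, ih, ← h2, show (n + 1) ^ 2 = n ^ 2 + (2 * n + 1) by ring, pow_add, pow_succ (-1 : ℂ)]
    ring

/-! ### The two Bailey-type summations and the Appell sum. -/

/-- `1 / (q; q)_m`, understood as `0` for negative `m`. -/
noncomputable def qInv (q : ℂ) (m : ℤ) : ℂ := if 0 ≤ m then (qPoch q q m.toNat)⁻¹ else 0

lemma qInv_natCast (q : ℂ) (m : ℕ) : qInv q m = (qPoch q q m)⁻¹ := by simp [qInv]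

lemma qInv_of_neg (q : ℂ) {m : ℤ} (hm : m < 0) : qInv q m = 0 := by simp [qInv, hm]

/-- With i = n - r and j = n + r one has i + j = 2n and r² = n² - ij, so this is Gauss's sum
`altSum_two_mul` with the power q^{n²} restored. -/
lemma tsum_qInv_mul_qInv {q : ℂ} (hq : ‖q‖ < 1) (hq0 : q ≠ 0) (n : ℕ) :
    ∑' r : ℤ, (-1) ^ r.natAbs * q ^ (r.natAbs ^ 2) * (qInv q (n - r) * qInv q (n + r)) =
      (qPoch (q ^ 2) (q ^ 2) n)⁻¹ := by
  have hqk : ∀ k : ℕ, q ^ k * q⁻¹ ^ k = 1 := fun k => by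
    rw [← mul_pow, mul_inv_cancel₀ hq0, one_pow]
  rw [tsum_eq_sum (s := (antidiagonal (2 * n)).image fun p => (p.2 : ℤ) - n), sum_image]
  · have hm : (qPoch (q ^ 2) (q ^ 2) n)⁻¹ = (-1) ^ n * q ^ (n ^ 2) * altSum q (2 * n) := by
      rw [altSum_two_mul hq hq0]
      have h1 : ((-1 : ℂ) ^ n) * (-1) ^ n = 1 := by rw [← mul_pow]; simp
      linear_combination -(qPoch (q ^ 2) (q ^ 2) n)⁻¹ * (h1 + (-1) ^ n * (-1) ^ n * hqk (n ^ 2))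
    rw [hm, altSum, mul_sum]
    refine sum_congr rfl fun p hp => ?_
    rw [HasAntidiagonal.mem_antidiagonal] at hp
    have e1 : (n : ℤ) - ((p.2 : ℤ) - n) = p.1 := by lia
    have e2 : (n : ℤ) + ((p.2 : ℤ) - n) = p.2 := by lia
    rw [e1, e2, qInv_natCast, qInv_natCast]
    have e3 : ((p.2 : ℤ) - n).natAbs ^ 2 + p.1 * p.2 = n ^ 2 := by
      zify
      rw [sq_abs]
      have : (p.1 : ℤ) = 2 * n - p.2 := by lia
      rw [this]; ring
    have e4 : (-1 : ℂ) ^ ((p.2 : ℤ) - n).natAbs = (-1) ^ n * (-1) ^ p.2 := by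
      rw [← pow_add]
      rcases Nat.even_or_odd (n + p.2) with h | h
      · rw [h.neg_one_pow, Even.neg_one_pow]
        rw [Int.natAbs_even]; grind
      · rw [h.neg_one_pow, Odd.neg_one_pow]
        rw [Int.natAbs_odd]; grind
    rw [e4, ← e3, pow_add]
    linear_combination (-(-1) ^ n * (-1) ^ p.2 * q ^ (((p.2 : ℤ) - n).natAbs ^ 2) *
      (qPoch q q p.1)⁻¹ * (qPoch q q p.2)⁻¹) * hqk (p.1 * p.2)
  · intro a ha b hb hab
    simp only [mem_coe, HasAntidiagonal.mem_antidiagonal] at ha hb hab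
    ext <;> lia
  · intro r hr
    by_cases h1 : (n : ℤ) - r < 0
    · simp [qInv_of_neg q h1]
    by_cases h2 : (n : ℤ) + r < 0
    · simp [qInv_of_neg q h2]
    exfalso
    apply hr
    simp only [mem_image, HasAntidiagonal.mem_antidiagonal]
    exact ⟨((n - r).toNat, (n + r).toNat), by simp; lia, by simp; lia⟩

lemma choose_two_add (k s : ℕ) :
    (k + s + 1).choose 2 = (s + 1).choose 2 + k.choose 2 + k * (s + 1) := by
  induction k with
  | zero => simp
  | succ k ih =>
    rw [show k + 1 + s + 1 = (k + s + 1) + 1 by ring, Nat.choose_succ_succ (k + s + 1),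
      Nat.choose_succ_succ k, ih]
    simp
    ring

/-- The terms n < s vanish; with n = k + s the rest is the limiting q-Gauss sum at A = -q^s, x =
-q^{s+1}, Ax = q^{2s+1}. The factor 2/(1 + q^s) comes from (-1;q)_{s+1} = 2 (-q;q)_s. -/
lemma tsum_qInv_mul_qInv_choose_nat {q : ℂ} (hq : ‖q‖ < 1) (s : ℕ) :
    ∑' n : ℕ, qPoch (-1) q n * q ^ ((n + 1).choose 2) * (qInv q (n - s) * qInv q (n + s)) =
      q ^ ((s + 1).choose 2) * (2 / (1 + q ^ s)) * (qPochInf (-q) q / qPochInf q q) := by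
  have hinj : Function.Injective fun k : ℕ => k + s := fun a b h => by simpa using h
  rw [← hinj.tsum_eq]
  swap
  · intro n hn
    by_contra h
    have : (n : ℤ) - s < 0 := by
      by_contra h'
      exact h ⟨n - s, by simp; lia⟩
    simp [qInv_of_neg q this] at hn
  have hx : ‖-q ^ (s + 1)‖ < 1 := by
    rw [norm_neg, norm_pow]; exact pow_lt_one₀ (norm_nonneg _) hq (by simp)
  have hAx' : ‖q * q ^ (2 * s)‖ < 1 := by
    rw [← pow_succ', norm_pow]; exact pow_lt_one₀ (norm_nonneg _) hq (by simp)
  have hAxe : -q ^ s * -q ^ (s + 1) = q * q ^ (2 * s) := by ring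
  have hAx : ‖-q ^ s * -q ^ (s + 1)‖ < 1 := by rw [hAxe]; exact hAx'
  have key := tsum_gaussTerm hq hx hAx
  have hterm : ∀ k : ℕ, qPoch (-1) q (k + s) * q ^ ((k + s + 1).choose 2) *
      (qInv q ((k + s : ℕ) - s) * qInv q ((k + s : ℕ) + s)) =
      qPoch (-1) q s * q ^ ((s + 1).choose 2) * (qPoch q q (2 * s))⁻¹ *
        gaussTerm q (-q ^ s) (-q ^ (s + 1)) k := by
    intro k
    have e1 : ((k + s : ℕ) : ℤ) - s = k := by push_cast; ring
    have e2 : ((k + s : ℕ) : ℤ) + s = (2 * s + k : ℕ) := by push_cast; ring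
    rw [e1, e2, qInv_natCast, qInv_natCast, gaussTerm, hAxe, choose_two_add,
      add_comm k s, qPoch_add (-1) q s k, qPoch_add q q (2 * s) k, pow_add, pow_add, mul_inv, neg_neg, ← pow_mul q (s + 1) k,
      mul_comm (s + 1) k, neg_one_mul]
    ring
  simp only [hterm, tsum_mul_left]
  rw [hAxe] at key
  have n1 := qPochInf_ne_zero hAx' hq
  have n2 := qPoch_ne_zero hq hq (2 * s)
  have h3 := qPochInf_eq_mul q hq (2 * s)
  have h4 := qPochInf_eq_mul (-q) hq s
  have h5 := qPoch_succ (-1) q s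
  rw [qPoch_succ', neg_one_mul] at h5
  have n3 := one_sub_mul_pow_ne_zero (a := -q) (by simpa using hq) hq
  have n4 : 1 + q ^ s ≠ 0 := by
    rcases s with _ | s
    · norm_num
    · have := n3 s
      rwa [neg_mul, sub_neg_eq_add, ← pow_succ'] at this
  have h6 : -q * q ^ s = -q ^ (s + 1) := by ring
  rw [h6, ← key] at h4
  rw [h3, h4]
  generalize ∑' k, gaussTerm q (-q ^ s) (-q ^ (s + 1)) k = W
  field_simp
  linear_combination (-W * q ^ (s + 1).choose 2) * h5

lemma tsum_qInv_mul_qInv_choose {q : ℂ} (hq : ‖q‖ < 1) (r : ℤ) :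
    ∑' n : ℕ, qPoch (-1) q n * q ^ ((n + 1).choose 2) * (qInv q (n - r) * qInv q (n + r)) =
      q ^ ((r.natAbs + 1).choose 2) * (2 / (1 + q ^ r.natAbs)) *
        (qPochInf (-q) q / qPochInf q q) := by
  rw [← tsum_qInv_mul_qInv_choose_nat hq]
  refine tsum_congr fun n => ?_
  rcases Int.natAbs_eq r with h | h
  · rw [← h]
  · generalize r.natAbs = s at h
    rw [h, sub_neg_eq_add, ← sub_eq_add_neg, mul_comm (qInv q (n + s))]

lemma norm_qInv_le {q : ℂ} (hq : ‖q‖ < 1) (m : ℤ) :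
    ‖qInv q m‖ ≤ Real.exp (‖q‖ / (1 - ‖q‖) * (1 - ‖q‖)⁻¹) := by
  rw [qInv]
  split_ifs
  · exact norm_qPoch_inv_le le_rfl hq hq _
  · simp [Real.exp_nonneg]

lemma summable_pow_natAbs {r : ℝ} (h0 : 0 ≤ r) (h1 : r < 1) :
    Summable fun n : ℤ => r ^ n.natAbs := by
  apply Summable.of_nat_of_neg <;> simpa using summable_geometric_of_lt_one h0 h1

lemma le_choose_two (n : ℕ) : n ≤ (n + 1).choose 2 := by
  rw [Nat.choose_succ_succ]; simp

/-- The general term of the double series which gives the Appell sum. -/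
noncomputable def doubleTerm (q : ℂ) (n : ℕ) (r : ℤ) : ℂ :=
  qPoch (-1) q n * q ^ ((n + 1).choose 2) *
    ((-1) ^ r.natAbs * q ^ (r.natAbs ^ 2) * (qInv q (n - r) * qInv q (n + r)))

lemma summable_doubleTerm {q : ℂ} (hq : ‖q‖ < 1) :
    Summable (Function.uncurry (doubleTerm q)) := by
  set E := Real.exp (‖q‖ / (1 - ‖q‖) * (1 - ‖q‖)⁻¹)
  set K := Real.exp (‖(-1 : ℂ)‖ * (1 - ‖q‖)⁻¹)
  have hs : Summable fun p : ℕ × ℤ => ‖q‖ ^ p.1 * ‖q‖ ^ p.2.natAbs :=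
    Summable.mul_of_nonneg (f := fun n : ℕ => ‖q‖ ^ n) (g := fun n : ℤ => ‖q‖ ^ n.natAbs)
      (summable_geometric_of_lt_one (norm_nonneg _) hq)
      (summable_pow_natAbs (norm_nonneg _) hq) (fun n => pow_nonneg (norm_nonneg q) n)
      (fun n => pow_nonneg (norm_nonneg q) n.natAbs)
  refine Summable.of_norm_bounded (hs.mul_left (K * E * E)) fun p => ?_
  simp only [Function.uncurry, doubleTerm, norm_mul, norm_pow, norm_neg, norm_one, one_pow, one_mul]
  have h1 := norm_qPoch_le (a := -1) hq p.1
  have h2 := norm_qInv_le hq (p.1 - p.2)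
  have h3 := norm_qInv_le hq (p.1 + p.2)
  have h4 : ‖q‖ ^ ((p.1 + 1).choose 2) ≤ ‖q‖ ^ p.1 :=
    pow_le_pow_of_le_one (norm_nonneg _) hq.le (le_choose_two _)
  have h5 : ‖q‖ ^ (p.2.natAbs ^ 2) ≤ ‖q‖ ^ p.2.natAbs :=
    pow_le_pow_of_le_one (norm_nonneg _) hq.le (Nat.le_self_pow two_ne_zero _)
  calc _ ≤ K * ‖q‖ ^ p.1 * (‖q‖ ^ p.2.natAbs * (E * E)) := by gcongr
    _ = _ := by ring

/-- The generating function as a quotient of infinite products times an Appell sum. -/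
lemma tsum_eq_appell {q : ℂ} (hq : ‖q‖ < 1) (hq0 : q ≠ 0) :
    ∑' n : ℕ, qPoch (-1) q n * q ^ ((n + 1).choose 2) * (qPoch (q ^ 2) (q ^ 2) n)⁻¹ =
      qPochInf (-q) q / qPochInf q q * ∑' r : ℤ, (-1) ^ r.natAbs * q ^ (r.natAbs ^ 2) *
        (q ^ ((r.natAbs + 1).choose 2) * (2 / (1 + q ^ r.natAbs))) := by
  have h1 : ∀ n : ℕ, qPoch (-1) q n * q ^ ((n + 1).choose 2) * (qPoch (q ^ 2) (q ^ 2) n)⁻¹ =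
      ∑' r : ℤ, doubleTerm q n r := fun n => by
    simp only [doubleTerm]
    rw [tsum_mul_left, tsum_qInv_mul_qInv hq hq0]
  have h2 : ∀ r : ℤ, ∑' n : ℕ, doubleTerm q n r =
      qPochInf (-q) q / qPochInf q q * ((-1) ^ r.natAbs * q ^ (r.natAbs ^ 2) *
        (q ^ ((r.natAbs + 1).choose 2) * (2 / (1 + q ^ r.natAbs)))) := fun r => by
    calc _ = ∑' n : ℕ, (-1) ^ r.natAbs * q ^ (r.natAbs ^ 2) *
          (qPoch (-1) q n * q ^ ((n + 1).choose 2) * (qInv q (n - r) * qInv q (n + r))) :=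
          tsum_congr fun n => by rw [doubleTerm]; ring
      _ = _ := by rw [tsum_mul_left, tsum_qInv_mul_qInv_choose hq r]; ring
  rw [tsum_congr h1, ← (summable_doubleTerm hq).tsum_comm, tsum_congr h2, tsum_mul_left]

end OddEvenOverpartition

namespace OddEvenOverpartition

/-! ### The generating function -/

lemma isChain_and {α : Type*} {R S : α → α → Prop} {l : List α} :
    l.IsChain (fun a b => R a b ∧ S a b) ↔ l.IsChain R ∧ l.IsChain S := by
  induction l with
  | nil => simp
  | cons a l ih =>
    simp only [List.isChain_cons, ih]
    grind

/-- The sum of the parts. -/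
def weight (l : List (ℕ × Bool)) : ℕ := (l.map Prod.fst).sum

/-- The relation between a part `a` and the next larger part `b`. -/
def PartRel (a b : ℕ × Bool) : Prop := a.1 < b.1 ∧ (a.2 = true ↔ Even (b.1 - a.1))

/-- Equality of successive parts is impossible: a nonoverlined smaller part has an odd, hence
nonzero, gap, and an overlined one is a first occurrence. So the gap is positive and its parity
determines the overline. -/
lemma partRel_iff (a b : ℕ × Bool) : PartRel a b ↔
    (a.1 ≤ b.1 ∧ (a.2 = true → a.1 ≠ b.1)) ∧
      (a.2 = false → Odd (b.1 - a.1)) ∧ (a.2 = true → Even (b.1 - a.1)) := by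
  obtain ⟨a, u⟩ := a
  obtain ⟨b, v⟩ := b
  rw [PartRel]
  rcases u
  · simp only [Bool.false_eq_true, false_iff, Nat.not_even_iff_odd, IsEmpty.forall_iff, and_true,
      forall_const]
    constructor
    · rintro ⟨h1, h2⟩; exact ⟨h1.le, h2⟩
    · rintro ⟨h1, h2⟩; exact ⟨by have := h2.pos; lia, h2⟩
  · simp only [true_iff, forall_const, reduceCtorEq, IsEmpty.forall_iff, true_and]
    constructor
    · rintro ⟨h1, h2⟩; exact ⟨⟨h1.le, h1.ne⟩, h2⟩
    · rintro ⟨⟨h1, h2⟩, h3⟩; exact ⟨lt_of_le_of_ne h1 h2, h3⟩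

/-- Lists of `m` parts in increasing order, subject to the conditions on successive parts. -/
def chains (m : ℕ) : Set (List (ℕ × Bool)) :=
  {l | l.length = m ∧ (∀ p ∈ l, 0 < p.1) ∧ l.IsChain PartRel}

/-- The lists in `chains m` whose smallest part is odd. -/
def oddChains (m : ℕ) : Set (List (ℕ × Bool)) := {l | l ∈ chains m ∧ ∀ p ∈ l.head?, Odd p.1}

/-- Add `e` to all parts. -/
def shift (e : ℕ) (l : List (ℕ × Bool)) : List (ℕ × Bool) := l.map fun p => (p.1 + e, p.2)

/-- Add `e` to all parts, and append `e` as the new smallest part. -/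
def extend (e : ℕ) (l : List (ℕ × Bool)) : List (ℕ × Bool) :=
  (e, decide (Even (l.headD (0, false)).1)) :: shift e l

lemma length_shift (e : ℕ) (l : List (ℕ × Bool)) : (shift e l).length = l.length := by simp [shift]

lemma weight_shift (e : ℕ) (l : List (ℕ × Bool)) :
    weight (shift e l) = weight l + l.length * e := by
  induction l with
  | nil => simp [weight, shift]
  | cons a l ih =>
    simp only [weight, shift, List.map_cons, List.sum_cons, List.length_cons] at *
    rw [ih]; ring

lemma weight_extend (e : ℕ) (l : List (ℕ × Bool)) :
    weight (extend e l) = weight l + (l.length + 1) * e := by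
  have : weight (extend e l) = e + weight (shift e l) := by simp [weight, extend]
  rw [this, weight_shift]; ring

lemma shift_injective (e : ℕ) : Function.Injective (shift e) := by
  refine List.map_injective_iff.mpr ?_
  rintro ⟨a, u⟩ ⟨b, v⟩ h
  simpa using h

lemma isChain_shift (e : ℕ) (l : List (ℕ × Bool)) :
    (shift e l).IsChain PartRel ↔ l.IsChain PartRel := by
  rw [shift, List.isChain_map]
  simp only [PartRel, Nat.add_sub_add_right, add_lt_add_iff_right]
  rfl

/-- After the shift, the gap above the new part e is the old smallest part, whose parity therefore
fixes the overline of e. The default in `headD` plays no role because the list is nonempty. -/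
lemma extend_mem_chains {m e : ℕ} (he : 0 < e) {l : List (ℕ × Bool)} (hl : l ∈ chains (m + 1)) :
    extend e l ∈ chains (m + 2) := by
  obtain ⟨h1, h2, h3⟩ := hl
  refine ⟨by simp [extend, length_shift, h1], ?_, ?_⟩
  · intro p hp
    simp only [extend, shift, List.mem_cons, List.mem_map] at hp
    rcases hp with rfl | ⟨a, _, rfl⟩
    · exact he
    · simp; lia
  · rw [extend, List.isChain_cons, isChain_shift]
    refine ⟨?_, h3⟩
    rcases l with _ | ⟨a, l⟩
    · simp at h1
    · have := h2 a (by simp)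
      simpa [shift, PartRel] using this

/-- Parts increase strictly, so subtracting the smallest from the others leaves positive parts with
the same gaps. -/
lemma exists_extend {m : ℕ} {l : List (ℕ × Bool)} (hl : l ∈ chains (m + 2)) :
    ∃ e, ∃ l' ∈ chains (m + 1), 0 < e ∧ extend e l' = l ∧ ∀ p ∈ l.head?, p.1 = e := by
  obtain ⟨h1, h2, h3⟩ := hl
  rcases l with _ | ⟨⟨e, β⟩, l⟩
  · simp at h1
  have hlt : ∀ p ∈ l, e < p.1 := by
    have hc : ((e, β) :: l).IsChain (fun a b => a.1 < b.1) := h3.imp fun a b h => h.1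
    have : ((e, β) :: l).Pairwise (fun a b => a.1 < b.1) := by
      have : IsTrans (ℕ × Bool) (fun a b => a.1 < b.1) := ⟨fun a b c => lt_trans⟩
      exact List.isChain_iff_pairwise.mp hc
    exact fun p hp => (List.pairwise_cons.mp this).1 p hp
  have hs : shift e (l.map fun p => (p.1 - e, p.2)) = l := by
    rw [shift, List.map_map]
    conv_rhs => rw [← List.map_id l]
    refine List.map_congr_left fun p hp => ?_
    have := hlt p hp
    ext
    · simp; lia
    · simp
  refine ⟨e, l.map fun p => (p.1 - e, p.2), ⟨by simpa using h1, ?_, ?_⟩, h2 (e, β) (by simp),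
    ?_, ?_⟩
  · intro p hp
    obtain ⟨a, ha, rfl⟩ := List.mem_map.mp hp
    have := hlt a ha
    simp; lia
  · rw [← isChain_shift e, hs]
    exact (List.isChain_cons.mp h3).2
  · rw [extend, hs]
    rcases l with _ | ⟨a, l⟩
    · simp at h1
    · have := (List.isChain_cons_cons.mp h3).1.2
      simp only [List.map_cons, List.headD_cons, List.cons.injEq, Prod.mk.injEq, true_and, and_true]
      grind
  · simp

lemma extend_injective : Function.Injective2 extend := by
  intro e e' l l' h
  simp only [extend, List.cons.injEq, Prod.mk.injEq] at h
  obtain ⟨⟨rfl, _⟩, h⟩ := h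
  exact ⟨rfl, shift_injective _ h⟩

lemma chains_one : chains 1 = Set.range fun p : Bool × ℕ => [(p.2 + 1, p.1)] := by
  ext l
  constructor
  · rintro ⟨h1, h2, _⟩
    obtain ⟨⟨a, b⟩, rfl⟩ := List.length_eq_one_iff.mp h1
    have := h2 (a, b) (by simp)
    exact ⟨(b, a - 1), by simp at this ⊢; lia⟩
  · rintro ⟨p, rfl⟩
    refine ⟨by simp, fun r hr => ?_, by simp⟩
    simp only [List.mem_singleton] at hr
    simp [hr]

lemma oddChains_one : oddChains 1 = Set.range fun p : Bool × ℕ => [(2 * p.2 + 1, p.1)] := by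
  ext l
  constructor
  · rintro ⟨⟨h1, h2, _⟩, h3⟩
    obtain ⟨⟨a, b⟩, rfl⟩ := List.length_eq_one_iff.mp h1
    have := h3 (a, b) (by simp)
    obtain ⟨k, hk⟩ := this
    exact ⟨(b, k), by simp at hk ⊢; lia⟩
  · rintro ⟨p, rfl⟩
    refine ⟨⟨by simp, fun r hr => ?_, by simp⟩, fun r hr => ?_⟩
    · simp only [List.mem_singleton] at hr
      simp [hr]
    · simp only [List.head?_cons, Option.mem_def, Option.some.injEq] at hr
      simp [← hr]

lemma chains_add_two (m : ℕ) : chains (m + 2) =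
    Set.range fun p : chains (m + 1) × ℕ => extend (p.2 + 1) p.1 := by
  ext l
  constructor
  · intro hl
    obtain ⟨e, l', hl', he, h, _⟩ := exists_extend hl
    exact ⟨(⟨l', hl'⟩, e - 1), by simp [Nat.sub_add_cancel he, h]⟩
  · rintro ⟨p, rfl⟩
    exact extend_mem_chains (by simp) p.1.2

lemma oddChains_add_two (m : ℕ) : oddChains (m + 2) =
    Set.range fun p : chains (m + 1) × ℕ => extend (2 * p.2 + 1) p.1 := by
  ext l
  constructor
  · intro hl
    obtain ⟨e, l', hl', he, h, h'⟩ := exists_extend hl.1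
    obtain ⟨k, hk⟩ : Odd e := by
      rw [← h] at hl
      exact hl.2 _ (by simp [extend]; rfl)
    exact ⟨(⟨l', hl'⟩, k), by simp [← hk, h]⟩
  · rintro ⟨p, rfl⟩
    exact ⟨extend_mem_chains (by simp) p.1.2, by simp [extend]⟩

lemma hasSum_of_eq {ι : Type*} {f g : ι → ℂ} {a b : ℂ} (h : HasSum f a) (hfg : ∀ i, g i = f i)
    (hab : b = a) : HasSum g b := by
  rw [hab, funext hfg]
  exact h

lemma hasSum_prod_mul {ι κ : Type*} {f : ι → ℂ} {g : κ → ℂ} {a b : ℂ} (hf : HasSum f a)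
    (hg : HasSum g b) : HasSum (fun p : ι × κ => f p.1 * g p.2) (a * b) :=
  HasSum.mul (f := f) (g := g) hf hg
    (summable_mul_of_summable_norm (f := f) (g := g) hf.summable.norm hg.summable.norm)

lemma hasSum_bool_mul {f : ℕ → ℂ} {a : ℂ} (hf : HasSum f a) :
    HasSum (fun p : Bool × ℕ => f p.2) (2 * a) := by
  have h1 : HasSum (fun _ : Bool => (1 : ℂ)) 2 :=
    hasSum_of_eq (hasSum_fintype (fun _ : Bool => (1 : ℂ))) (fun _ => rfl) (by simp)
  exact hasSum_of_eq (hasSum_prod_mul h1 hf) (fun p => (one_mul _).symm) rfl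

lemma hasSum_pow_mul_succ {q : ℂ} (hq : ‖q‖ < 1) (m : ℕ) :
    HasSum (fun k : ℕ => q ^ ((m + 1) * (k + 1))) (q ^ (m + 1) * (1 - q ^ (m + 1))⁻¹) := by
  have h1 : ‖q ^ (m + 1)‖ < 1 := by rw [norm_pow]; exact pow_lt_one₀ (norm_nonneg _) hq (by simp)
  refine hasSum_of_eq ((hasSum_geometric_of_norm_lt_one h1).mul_left (q ^ (m + 1)))
    (fun k => ?_) rfl
  rw [← pow_mul, ← pow_add]; ring_nf

lemma hasSum_pow_mul_odd {q : ℂ} (hq : ‖q‖ < 1) (m : ℕ) :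
    HasSum (fun k : ℕ => q ^ ((m + 1) * (2 * k + 1)))
      (q ^ (m + 1) * (1 - (q ^ 2) ^ (m + 1))⁻¹) := by
  have h1 : ‖(q ^ 2) ^ (m + 1)‖ < 1 := by
    rw [← pow_mul, norm_pow]; exact pow_lt_one₀ (norm_nonneg _) hq (by simp)
  refine hasSum_of_eq ((hasSum_geometric_of_norm_lt_one h1).mul_left (q ^ (m + 1)))
    (fun k => ?_) rfl
  rw [← pow_mul, ← pow_mul, ← pow_add]; ring_nf

/-- A new smallest part e raises the weight by (m + 2)e: once for itself, and once for each of the m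
+ 1 shifted parts. By injectivity of the construction the sum factors. -/
lemma hasSum_range_extend {q : ℂ} {m : ℕ} {S T : Set (List (ℕ × Bool))} {g : ℕ → ℕ}
    (hg : Function.Injective g) (hS : S ⊆ chains (m + 1))
    (hT : T = Set.range fun p : S × ℕ => extend (g p.2) p.1)
    {a b : ℂ} (ha : HasSum (fun l : S => q ^ weight l) a)
    (hb : HasSum (fun k => q ^ ((m + 2) * g k)) b) :
    HasSum (fun l : T => q ^ weight l) (a * b) := by
  subst hT
  have hinj : Function.Injective fun p : S × ℕ => extend (g p.2) p.1 := by
    rintro ⟨⟨l, hl⟩, k⟩ ⟨⟨l', hl'⟩, k'⟩ h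
    obtain ⟨h1, h2⟩ := extend_injective h
    obtain rfl : l = l' := h2
    obtain rfl : k = k' := hg h1
    rfl
  rw [hinj.hasSum_range_iff (f := fun l => q ^ weight l)]
  refine hasSum_of_eq (hasSum_prod_mul ha hb) (fun p => ?_) rfl
  simp only [Function.comp, weight_extend, pow_add, (hS p.1.2).1]

/-- The 2 counts the free overline of the largest part; passing to j parts multiplies by ∑_{e ≥ 1}
q^{je} = q^j/(1 - q^j). -/
lemma hasSum_chains {q : ℂ} (hq : ‖q‖ < 1) (m : ℕ) :
    HasSum (fun l : chains (m + 1) => q ^ weight l)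
      (2 * q ^ ((m + 2).choose 2) * (qPoch q q (m + 1))⁻¹) := by
  induction m with
  | zero =>
    have hinj : Function.Injective fun p : Bool × ℕ => [(p.2 + 1, p.1)] := by
      rintro ⟨b, k⟩ ⟨b', k'⟩ h
      simp at h
      grind
    have e : chains (0 + 1) = Set.range fun p : Bool × ℕ => [(p.2 + 1, p.1)] := chains_one
    rw [e, hinj.hasSum_range_iff (f := fun l => q ^ weight l)]
    refine hasSum_of_eq (hasSum_bool_mul (hasSum_pow_mul_succ hq 0)) (fun p => ?_) ?_
    · simp [weight]
    · simp [qPoch]; ring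
  | succ m ih =>
    have := hasSum_range_extend (add_left_injective 1) subset_rfl (chains_add_two m) ih
      (hasSum_pow_mul_succ hq (m + 1))
    refine hasSum_of_eq this (fun _ => rfl) ?_
    rw [qPoch_succ, mul_inv, Nat.choose_succ_succ (m + 2), Nat.choose_one_right, pow_add,
      ← pow_succ' q (m + 1)]
    ring

/-- The contribution of the overpartitions with `m` parts to the generating function. -/
noncomputable def partTerm (q : ℂ) (m : ℕ) : ℂ :=
  qPoch (-1) q m * q ^ ((m + 1).choose 2) * (qPoch (q ^ 2) (q ^ 2) m)⁻¹

lemma qPoch_neg_ne_zero {q : ℂ} (hq : ‖q‖ < 1) (n : ℕ) : qPoch (-q) q n ≠ 0 :=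
  qPoch_ne_zero (by simpa using hq) hq n

lemma partTerm_succ {q : ℂ} (hq : ‖q‖ < 1) (m : ℕ) :
    partTerm q (m + 1) =
      2 * q ^ ((m + 2).choose 2) * (qPoch q q m)⁻¹ * (1 - (q ^ 2) ^ (m + 1))⁻¹ := by
  have h1 := qPoch_neg_ne_zero hq m
  rw [partTerm, qPoch_succ', neg_one_mul, qPoch_succ (q ^ 2), ← qPoch_neg_mul, mul_inv, mul_inv,
    ← pow_succ']
  field_simp
  ring

/-- Only the part added last must be odd, so only the last factor changes, to q^m/(1 - q^{2m}). -/
lemma hasSum_oddChains {q : ℂ} (hq : ‖q‖ < 1) (m : ℕ) :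
    HasSum (fun l : oddChains m => q ^ weight l) (partTerm q m) := by
  match m with
  | 0 =>
    have : oddChains 0 = {[]} := by
      ext l
      simp only [oddChains, chains, Set.mem_ofPred_eq, List.length_eq_zero_iff, Set.mem_singleton_iff]
      constructor
      · exact fun h => h.1.1
      · rintro rfl; simp
    rw [this]
    refine hasSum_of_eq (hasSum_fintype _) (fun _ => rfl) ?_
    simp [weight, partTerm]
  | 1 =>
    have hinj : Function.Injective fun p : Bool × ℕ => [(2 * p.2 + 1, p.1)] := by
      rintro ⟨b, k⟩ ⟨b', k'⟩ h
      simp at h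
      grind
    rw [oddChains_one, hinj.hasSum_range_iff (f := fun l => q ^ weight l)]
    refine hasSum_of_eq (hasSum_bool_mul (hasSum_pow_mul_odd hq 0)) (fun p => ?_) ?_
    · simp [weight]
    · rw [partTerm_succ hq]; simp; ring
  | m + 2 =>
    have hg : Function.Injective fun k : ℕ => 2 * k + 1 := fun a b h => by simp at h; lia
    refine hasSum_of_eq (hasSum_range_extend hg subset_rfl (oddChains_add_two m)
      (hasSum_chains hq m) (hasSum_pow_mul_odd hq (m + 1))) (fun _ => rfl) ?_
    rw [partTerm_succ hq, Nat.choose_succ_succ (m + 2), Nat.choose_one_right, pow_add]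
    ring

lemma norm_partTerm_le {q : ℂ} (hq : ‖q‖ < 1) : ∃ K : ℝ, ∀ m, ‖partTerm q m‖ ≤ K * ‖q‖ ^ m := by
  have hq2 : ‖q ^ 2‖ < 1 := by rw [norm_pow]; exact pow_lt_one₀ (norm_nonneg _) hq two_ne_zero
  refine ⟨Real.exp (‖(-1 : ℂ)‖ * (1 - ‖q‖)⁻¹) *
    Real.exp (‖q ^ 2‖ / (1 - ‖q ^ 2‖) * (1 - ‖q ^ 2‖)⁻¹), fun m => ?_⟩
  have h1 := norm_qPoch_le (a := -1) hq m
  have h2 := norm_qPoch_inv_le le_rfl hq2 hq2 m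
  have h4 : ‖q‖ ^ ((m + 1).choose 2) ≤ ‖q‖ ^ m :=
    pow_le_pow_of_le_one (norm_nonneg _) hq.le (le_choose_two _)
  rw [partTerm, norm_mul, norm_mul, norm_pow, mul_right_comm]
  gcongr

lemma summable_partTerm {q : ℂ} (hq : ‖q‖ < 1) : Summable (partTerm q) := by
  obtain ⟨K, hK⟩ := norm_partTerm_le hq
  exact Summable.of_norm_bounded ((summable_geometric_of_lt_one (norm_nonneg _) hq).mul_left K) hK

/-- The overpartitions, of any number, that are odd-even. -/
def oddEvenLists : Set (List (ℕ × Bool)) :=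
  {l | IsOverpartition (weight l) l ∧ IsOddEven l}

lemma reverse_mem_oddEvenLists (l : List (ℕ × Bool)) :
    l.reverse ∈ oddEvenLists ↔ l ∈ oddChains l.length := by
  have h : l.IsChain PartRel ↔ l.reverse.IsChain
      (fun a b => b.1 ≤ a.1 ∧ (b.2 = true → b.1 ≠ a.1)) ∧ l.reverse.IsChain
      (fun a b => (b.2 = false → Odd (a.1 - b.1)) ∧ (b.2 = true → Even (a.1 - b.1))) := by
    rw [← isChain_and, List.isChain_reverse]
    constructor
    · exact fun h => h.imp fun a b => (partRel_iff a b).mp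
    · exact fun h => h.imp fun a b => (partRel_iff a b).mpr
  simp only [oddEvenLists, oddChains, chains, Set.mem_ofPred_eq, IsOverpartition, IsOddEven, h,
    weight, List.mem_reverse, List.getLast?_reverse, true_and]
  tauto

lemma oddEvenLists_eq : oddEvenLists =
    Set.range fun p : Σ m, oddChains m => (p.2 : List (ℕ × Bool)).reverse := by
  ext l
  constructor
  · intro hl
    rw [← l.reverse_reverse, reverse_mem_oddEvenLists] at hl
    exact ⟨⟨_, ⟨_, hl⟩⟩, by simp⟩
  · rintro ⟨⟨m, ⟨l, hl⟩⟩, rfl⟩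
    have := hl.1.1
    simp only
    rw [reverse_mem_oddEvenLists, this]
    exact hl

lemma weight_reverse (l : List (ℕ × Bool)) : weight l.reverse = weight l := by
  simp [weight]

lemma hasSum_oddEvenLists {q : ℂ} (hq : ‖q‖ < 1) :
    HasSum (fun l : oddEvenLists => q ^ weight l) (∑' m, partTerm q m) := by
  have hinj : Function.Injective
      fun p : Σ m, oddChains m => (p.2 : List (ℕ × Bool)).reverse := by
    rintro ⟨m, l, hl⟩ ⟨m', l', hl'⟩ h
    simp only [List.reverse_inj] at h
    subst h
    obtain rfl : m = m' := hl.1.1.symm.trans hl'.1.1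
    rfl
  rw [oddEvenLists_eq, hinj.hasSum_range_iff (f := fun l => q ^ weight l)]
  simp only [Function.comp_def, weight_reverse]
  refine HasSum.sigma_of_hasSum (summable_partTerm hq).hasSum (fun m => hasSum_oddChains hq m) ?_
  -- Absolute summability over all lists is read off from the same identities at the nonnegative
  -- point ‖q‖.
  have hq' : ‖((‖q‖ : ℝ) : ℂ)‖ < 1 := by simpa using hq
  have h1 : ∀ m, HasSum (fun l : oddChains m => (((‖q‖ ^ weight l : ℝ)) : ℂ))
      (partTerm (‖q‖ : ℝ) m) := fun m => by
    simpa using hasSum_oddChains hq' m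
  rw [← summable_norm_iff, summable_sigma_of_nonneg (fun _ => norm_nonneg _)]
  simp only [norm_pow]
  refine ⟨fun m => Complex.summable_ofReal.mp (h1 m).summable, ?_⟩
  rw [← Complex.summable_ofReal]
  refine (summable_partTerm hq').congr fun m => ?_
  rw [Complex.ofReal_tsum, (h1 m).tsum_eq]

/-- On an infinite fibre the series at q = 1/2 would contain the constant 2^{-n} infinitely often.
Finiteness is needed because `Set.ncard` is 0 on infinite sets. -/
lemma finite_fiber (n : ℕ) : Finite {l : oddEvenLists // weight l = n} := by
  by_contra h
  rw [not_finite_iff_infinite] at h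
  have h2 : ‖(1 / 2 : ℂ)‖ < 1 := by norm_num
  have h1 := (hasSum_oddEvenLists h2).summable.comp_injective
    (Subtype.val_injective (p := fun l : oddEvenLists => weight l = n))
  have h3 : (fun _ : {l : oddEvenLists // weight l = n} => ((1 / 2 : ℂ)) ^ n) =
      (fun l : oddEvenLists => (1 / 2 : ℂ) ^ weight l) ∘ Subtype.val := by
    ext l
    simp [l.2]
  rw [← h3, summable_const_iff] at h1
  simp at h1

lemma natCard_fiber (n : ℕ) : Nat.card {l : oddEvenLists // weight l = n} = count n := by
  rw [count, ← Nat.card_coe_set_eq]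
  refine Nat.card_congr ⟨fun l => ⟨l.1.1, ?_⟩, fun l => ⟨⟨l.1, ?_⟩, ?_⟩, fun _ => rfl, fun _ => rfl⟩
  · have := l.1.2
    simp only [oddEvenLists, Set.mem_ofPred_eq, l.2] at this
    exact this
  · have h := l.2.1.2.2
    simp only [oddEvenLists, Set.mem_ofPred_eq, weight, h]
    exact l.2
  · exact l.2.1.2.2

lemma hasSum_count {q : ℂ} (hq : ‖q‖ < 1) :
    HasSum (fun n => (count n : ℂ) * q ^ n) (∑' m, partTerm q m) := by
  have h := (Equiv.sigmaFiberEquiv fun l : oddEvenLists => weight l).hasSum_iff.mpr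
    (hasSum_oddEvenLists hq)
  refine h.sigma fun n => ?_
  have := finite_fiber n
  have := Fintype.ofFinite {l : oddEvenLists // weight l = n}
  refine hasSum_of_eq (hasSum_fintype _) (fun _ => rfl) ?_
  have h1 : ∀ l : {l : oddEvenLists // weight l = n},
      ((fun l : oddEvenLists => q ^ weight l) ∘
        (Equiv.sigmaFiberEquiv fun l : oddEvenLists => weight l)) ⟨n, l⟩ = q ^ n := fun l => by
    simp [Equiv.sigmaFiberEquiv, l.2]
  rw [Finset.sum_congr rfl fun l _ => h1 l]
  simp [← natCard_fiber, Nat.card_eq_fintype_card]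

lemma genFun_eq {q : ℂ} (hq : ‖q‖ < 1) : genFun q = ∑' m, partTerm q m :=
  (hasSum_count hq).tsum_eq

end OddEvenOverpartition

namespace OddEvenOverpartition

/-! ### Bounds away from the dominant singularity -/

/-- In the series of -log|1 - z| the linear term keeps its real part, and only the terms z^n/n with
n ≥ 2 are replaced by absolute values. -/
lemma norm_one_sub_inv_le {z : ℂ} (hz : ‖z‖ < 1) :
    ‖(1 - z)⁻¹‖ ≤ Real.exp (z.re + (-Real.log (1 - ‖z‖) - ‖z‖)) := by
  have hne : 1 - z ≠ 0 := by
    intro h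
    rw [← sub_eq_zero.mp h] at hz
    simp at hz
  have h1 : HasSum (fun n : ℕ => (z ^ n / n).re) (-Real.log ‖1 - z‖) := by
    have := Complex.hasSum_re (Complex.hasSum_taylorSeries_neg_log hz)
    simpa [Complex.log_re] using this
  have h2 : HasSum (fun n : ℕ => ‖z‖ ^ n / n) (-Real.log (1 - ‖z‖)) := by
    have h := Complex.hasSum_taylorSeries_neg_log (z := (‖z‖ : ℂ)) (by simpa using hz)
    have h' := Complex.hasSum_re h
    simp only [Complex.neg_re, Complex.log_re] at h'
    rw [show (1 - (‖z‖ : ℂ)) = ((1 - ‖z‖ : ℝ) : ℂ) by push_cast; ring, Complex.norm_real,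
      Real.norm_eq_abs, Real.log_abs] at h'
    convert h' using 2 with n
    rw [← Complex.ofReal_pow, ← Complex.ofReal_natCast, ← Complex.ofReal_div, Complex.ofReal_re]
  have h3 := h2.add (hasSum_ite_eq 1 (z.re - ‖z‖))
  have h4 : -Real.log ‖1 - z‖ ≤ -Real.log (1 - ‖z‖) + (z.re - ‖z‖) := by
    refine hasSum_le (fun n => ?_) h1 h3
    by_cases hn : n = 1
    · simp [hn]
    · simp only [hn, if_false, add_zero]
      calc (z ^ n / n).re ≤ ‖z ^ n / n‖ := Complex.re_le_norm _
        _ = _ := by simp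
  rw [norm_inv, ← Real.exp_log (inv_pos.mpr (norm_pos_iff.mpr hne)), Real.log_inv]
  gcongr
  linarith

lemma exp_neg_div_le {x : ℝ} (hx : 0 < x) :
    Real.exp (-x) / (1 - Real.exp (-x)) ≤ 1 / x := by
  have h1 : 0 < 1 - Real.exp (-x) := by
    have : Real.exp (-x) < 1 := by simpa using hx
    linarith
  rw [div_le_div_iff₀ h1 hx]
  have h2 : x + 1 ≤ Real.exp x := Real.add_one_le_exp x
  have h3 : Real.exp x * Real.exp (-x) = 1 := by rw [← Real.exp_add]; simp
  have := mul_le_mul_of_nonneg_right h2 (Real.exp_pos (-x)).le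
  nlinarith

/-- With u = e^{-tn}, the k-th powers in the logarithmic series form a geometric sum over j, at most
(1 - u^k)/(k² t). Summing 1/k² over k ≥ 2 gives π²/6 - 1; the savings u^k/k² are kept only for k = 2
and k = 3. -/
lemma sum_neg_log_le {t : ℝ} (ht : 0 < t) (n : ℕ) :
    ∑ j ∈ range n, (-Real.log (1 - Real.exp (-t) ^ (j + 1)) - Real.exp (-t) ^ (j + 1)) ≤
      1 / t * (Real.pi ^ 2 / 6 - 1 - (Real.exp (-t) ^ n) ^ 2 / 4 - (Real.exp (-t) ^ n) ^ 3 / 9) := by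
  set r := Real.exp (-t) with hr
  have hr0 : 0 < r := Real.exp_pos _
  have hr1 : r < 1 := by rw [hr]; simpa using ht
  set u := r ^ n with hu
  have hu0 : 0 < u := by positivity
  have h1 : ∀ j : ℕ, HasSum (fun k : ℕ => (r ^ (j + 1)) ^ (k + 1) / (k + 1))
      (-Real.log (1 - r ^ (j + 1))) := fun j => by
    refine Real.hasSum_pow_div_log_of_abs_lt_one ?_
    rw [abs_of_pos (by positivity)]
    exact pow_lt_one₀ hr0.le hr1 (by simp)
  have h2 : HasSum (fun k : ℕ => ∑ j ∈ range n, (r ^ (j + 1)) ^ (k + 1) / (k + 1))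
      (∑ j ∈ range n, -Real.log (1 - r ^ (j + 1))) := hasSum_sum fun j _ => h1 j
  have h3 := h2.sub (hasSum_ite_eq 0 (∑ j ∈ range n, r ^ (j + 1)))
  have h4 : HasSum (fun k : ℕ => 1 / ((k : ℝ) + 1) ^ 2) (Real.pi ^ 2 / 6) := by
    have := (hasSum_nat_add_iff' 1).mpr hasSum_zeta_two
    simpa using this
  have h5 := (((h4.sub (hasSum_ite_eq 0 (1 : ℝ))).sub (hasSum_ite_eq 1 (u ^ 2 / 4))).sub
    (hasSum_ite_eq 2 (u ^ 3 / 9))).mul_left (1 / t)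
  rw [sum_sub_distrib]
  refine hasSum_le (fun k => ?_) h3 h5
  have hgen : ∑ j ∈ range n, (r ^ (j + 1)) ^ (k + 1) / (k + 1) ≤
      1 / t * ((1 - u ^ (k + 1)) / ((k : ℝ) + 1) ^ 2) := by
    have hρ1 : r ^ (k + 1) < 1 := pow_lt_one₀ hr0.le hr1 (by simp)
    have e1 : ∑ j ∈ range n, (r ^ (j + 1)) ^ (k + 1) / (k + 1) =
        1 / (k + 1) * (1 - u ^ (k + 1)) * (r ^ (k + 1) / (1 - r ^ (k + 1))) := by
      have hg := geom_sum_eq hρ1.ne n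
      have : ∀ j ∈ range n, (r ^ (j + 1)) ^ (k + 1) / ((k : ℝ) + 1) =
          r ^ (k + 1) / (k + 1) * (r ^ (k + 1)) ^ j := fun j _ => by ring
      rw [sum_congr rfl this, ← mul_sum, hg, hu, ← pow_mul, ← pow_mul, mul_comm n]
      have : r ^ (k + 1) - 1 ≠ 0 := by linarith
      have : 1 - r ^ (k + 1) ≠ 0 := by linarith
      field_simp
      ring
    have e2 : r ^ (k + 1) = Real.exp (-((k + 1) * t)) := by
      rw [hr, ← Real.exp_nat_mul]; push_cast; ring_nf
    have e3 := exp_neg_div_le (x := (k + 1) * t) (by positivity)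
    rw [← e2] at e3
    rw [e1]
    have hu1 : u ^ (k + 1) ≤ 1 := pow_le_one₀ hu0.le (pow_le_one₀ hr0.le hr1.le)
    calc 1 / ((k : ℝ) + 1) * (1 - u ^ (k + 1)) * (r ^ (k + 1) / (1 - r ^ (k + 1)))
        ≤ 1 / ((k : ℝ) + 1) * (1 - u ^ (k + 1)) * (1 / ((k + 1) * t)) := by
          have : 0 ≤ 1 - u ^ (k + 1) := by linarith
          gcongr
      _ = _ := by field_simp
  match k with
  | 0 => simp
  | 1 => norm_num at hgen ⊢; linarith
  | 2 => norm_num at hgen ⊢; linarith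
  | k + 3 =>
    simp only [Nat.add_eq_zero_iff, OfNat.ofNat_ne_zero, and_false, if_false, sub_zero,
      show k + 3 ≠ 1 by lia, show k + 3 ≠ 2 by lia]
    refine hgen.trans ?_
    have : 0 ≤ u ^ (k + 3 + 1) := by positivity
    gcongr
    linarith

lemma norm_qPoch_inv_le_exp {q : ℂ} {t : ℝ} (ht : 0 < t) (hq : ‖q‖ = Real.exp (-t)) (n : ℕ) :
    ‖(qPoch q q n)⁻¹‖ ≤ Real.exp (2 / ‖1 - q‖ + 1 / t * (Real.pi ^ 2 / 6 - 1 -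
      (Real.exp (-t) ^ n) ^ 2 / 4 - (Real.exp (-t) ^ n) ^ 3 / 9)) := by
  have hq1 : ‖q‖ < 1 := by rw [hq]; simpa using ht
  have hne : 1 - q ≠ 0 := by simpa using one_sub_mul_pow_ne_zero hq1 hq1 0
  rw [qPoch, ← prod_inv_distrib, norm_prod]
  calc ∏ k ∈ range n, ‖(1 - q * q ^ k)⁻¹‖
      ≤ ∏ k ∈ range n, Real.exp ((q ^ (k + 1)).re +
          (-Real.log (1 - Real.exp (-t) ^ (k + 1)) - Real.exp (-t) ^ (k + 1))) := by
        refine prod_le_prod (fun _ _ => norm_nonneg _) fun k _ => ?_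
        rw [← pow_succ', ← hq, ← norm_pow]
        refine norm_one_sub_inv_le ?_
        rw [norm_pow]
        exact pow_lt_one₀ (norm_nonneg _) hq1 (by simp)
    _ = Real.exp ((∑ k ∈ range n, q ^ (k + 1)).re + ∑ k ∈ range n,
          (-Real.log (1 - Real.exp (-t) ^ (k + 1)) - Real.exp (-t) ^ (k + 1))) := by
        rw [← Real.exp_sum, sum_add_distrib, Complex.re_sum]
    _ ≤ _ := by
        gcongr
        · refine (Complex.re_le_norm _).trans ?_
          have h1 : ∑ k ∈ range n, q ^ (k + 1) = q * (1 - q ^ n) / (1 - q) := by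
            rw [eq_div_iff hne]
            simp_rw [pow_succ']
            rw [← mul_sum, mul_assoc, mul_comm (∑ i ∈ range n, q ^ i), mul_neg_geom_sum]
          rw [h1, norm_div, norm_mul]
          gcongr
          have h2 : ‖q ^ n‖ ≤ 1 := by rw [norm_pow]; exact pow_le_one₀ (norm_nonneg _) hq1.le
          have h3 : ‖1 - q ^ n‖ ≤ 2 := by
            have := norm_sub_le (1 : ℂ) (q ^ n)
            rw [norm_one] at this
            linarith
          nlinarith [norm_nonneg q, norm_nonneg (1 - q ^ n)]
        · exact sum_neg_log_le ht n

/-- 0.589 approximates the minimiser of the right-hand side. Without the cubic term the minimum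
would be 1/6, below 1 - π²/12, which is why `sum_neg_log_le` keeps the terms of order 3. -/
lemma quadratic_cubic_bound {u : ℝ} (h0 : 0 ≤ u) :
    1 - Real.pi ^ 2 / 12 + 1 / 100 ≤ (1 - u) ^ 2 / 2 + u ^ 2 / 4 + u ^ 3 / 9 := by
  have hpi : 3.14 < Real.pi := Real.pi_gt_d2
  have h1 : 9.8596 ≤ Real.pi ^ 2 := by nlinarith
  nlinarith [mul_nonneg h0 (sq_nonneg (u - 0.589)), sq_nonneg (u - 0.589)]

lemma norm_partTerm_le_exp {q : ℂ} {t : ℝ} (ht : 0 < t) (hq : ‖q‖ = Real.exp (-t)) (n : ℕ) :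
    ‖partTerm q n‖ ≤ 2 / (1 - Real.exp (-t)) *
      Real.exp (1 / t * (Real.pi ^ 2 / 4 - 2 - 1 / 100) + 2 / ‖1 - q‖) * Real.exp (-t / 2) ^ n := by
  have hq1 : ‖q‖ < 1 := by rw [hq]; simpa using ht
  have hr : 0 < 1 - Real.exp (-t) := by rw [← hq]; linarith
  rcases n with _ | m
  · have h1 : (1 : ℝ) ≤ 2 / (1 - Real.exp (-t)) := by
      rw [le_div_iff₀ hr]
      have := Real.exp_pos (-t)
      linarith
    have h2 : 0 ≤ Real.pi ^ 2 / 4 - 2 - 1 / 100 := by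
      have hpi : 3.14 < Real.pi := Real.pi_gt_d2
      nlinarith
    have h3 : 1 ≤ Real.exp (1 / t * (Real.pi ^ 2 / 4 - 2 - 1 / 100) + 2 / ‖1 - q‖) :=
      Real.one_le_exp (by positivity)
    have h4 := one_le_mul_of_one_le_of_one_le h1 h3
    simpa [partTerm] using h4
  · set n := m + 1 with hn
    have e1 : partTerm q n = 2 * q ^ ((n + 1).choose 2) * (qPoch q q n)⁻¹ * (1 + q ^ n)⁻¹ := by
      have hm := one_sub_mul_pow_ne_zero hq1 hq1 m
      have hm' := one_sub_mul_pow_ne_zero (a := -q) (by simpa using hq1) hq1 m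
      rw [← pow_succ'] at hm
      rw [neg_mul, ← pow_succ', sub_neg_eq_add] at hm'
      have e0 : 1 - (q ^ 2) ^ (m + 1) = (1 - q ^ (m + 1)) * (1 + q ^ (m + 1)) := by ring
      rw [hn, partTerm_succ hq1, ← qPoch_inv_succ_mul hq1 m, e0, mul_inv]
      field_simp
    have e2 : ‖(1 + q ^ n)⁻¹‖ ≤ 1 / (1 - Real.exp (-t)) := by
      rw [norm_inv, ← one_div]
      apply one_div_le_one_div_of_le hr
      have h1 : ‖q ^ n‖ ≤ ‖q‖ := by
        rw [norm_pow]; exact pow_le_of_le_one (norm_nonneg _) hq1.le (by simp [hn])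
      have h2 := norm_sub_norm_le (1 : ℂ) (-q ^ n)
      rw [norm_one, sub_neg_eq_add, norm_neg] at h2
      rw [← hq]
      linarith
    -- The split n(n+1)/2 = n²/2 + n/2 spends the Gaussian on the exponent and leaves a geometric
    -- factor for summing over n.
    have e3 : ‖q‖ ^ ((n + 1).choose 2) = Real.exp (-(t * n ^ 2 / 2)) * Real.exp (-t / 2) ^ n := by
      have hc : (((n + 1).choose 2 : ℕ) : ℝ) = n * (n + 1) / 2 := by
        rw [Nat.cast_choose_two]; push_cast; ring
      rw [hq, ← Real.exp_nat_mul, ← Real.exp_nat_mul, ← Real.exp_add, hc]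
      congr 1
      ring
    have e4 := norm_qPoch_inv_le_exp ht hq n
    -- With u = e^{-tn}, the Gaussian enters only through tn ≥ 1 - u, which leaves an inequality in
    -- u alone.
    have e5 : 2 / ‖1 - q‖ + 1 / t * (Real.pi ^ 2 / 6 - 1 -
        (Real.exp (-t) ^ n) ^ 2 / 4 - (Real.exp (-t) ^ n) ^ 3 / 9) - t * n ^ 2 / 2 ≤
        1 / t * (Real.pi ^ 2 / 4 - 2 - 1 / 100) + 2 / ‖1 - q‖ := by
      have h1 : Real.exp (-t) ^ n = Real.exp (-(t * n)) := by
        rw [← Real.exp_nat_mul]; congr 1; ring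
      set u := Real.exp (-t) ^ n with hu
      have hu0 : 0 ≤ u := by positivity
      have h2 : 1 - u ≤ t * n := by
        have := Real.add_one_le_exp (-(t * n))
        rw [← h1] at this
        linarith
      have hu1 : u ≤ 1 := pow_le_one₀ (Real.exp_pos _).le (by simpa using ht.le)
      have h3 : (1 - u) ^ 2 ≤ (t * n) ^ 2 := pow_le_pow_left₀ (by linarith) h2 2
      have h4 := quadratic_cubic_bound hu0
      have h5 : t * n ^ 2 / 2 = 1 / t * ((t * n) ^ 2 / 2) := by field_simp
      rw [h5]
      have h6 : 1 / t * (Real.pi ^ 2 / 6 - 1 - u ^ 2 / 4 - u ^ 3 / 9 - (t * n) ^ 2 / 2) ≤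
          1 / t * (Real.pi ^ 2 / 4 - 2 - 1 / 100) := by
        exact mul_le_mul_of_nonneg_left (by linarith) (by positivity)
      linarith
    rw [e1, norm_mul, norm_mul, norm_mul, norm_pow, e3, Complex.norm_ofNat]
    calc 2 * (Real.exp (-(t * n ^ 2 / 2)) * Real.exp (-t / 2) ^ n) * ‖(qPoch q q n)⁻¹‖ *
          ‖(1 + q ^ n)⁻¹‖
        ≤ 2 * (Real.exp (-(t * n ^ 2 / 2)) * Real.exp (-t / 2) ^ n) *
          Real.exp (2 / ‖1 - q‖ + 1 / t * (Real.pi ^ 2 / 6 - 1 -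
      (Real.exp (-t) ^ n) ^ 2 / 4 - (Real.exp (-t) ^ n) ^ 3 / 9)) * (1 / (1 - Real.exp (-t))) := by
          gcongr
      _ = 2 / (1 - Real.exp (-t)) * Real.exp (2 / ‖1 - q‖ + 1 / t * (Real.pi ^ 2 / 6 - 1 -
        (Real.exp (-t) ^ n) ^ 2 / 4 - (Real.exp (-t) ^ n) ^ 3 / 9) - t * n ^ 2 / 2) *
          Real.exp (-t / 2) ^ n := by
          rw [sub_eq_add_neg _ (t * (n : ℝ) ^ 2 / 2), Real.exp_add _ (-(t * (n : ℝ) ^ 2 / 2))]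
          ring
      _ ≤ _ := by gcongr

lemma norm_genFun_le {q : ℂ} {t : ℝ} (ht : 0 < t) (hq : ‖q‖ = Real.exp (-t)) :
    ‖genFun q‖ ≤ 2 / (1 - Real.exp (-t)) *
      Real.exp (1 / t * (Real.pi ^ 2 / 4 - 2 - 1 / 100) + 2 / ‖1 - q‖) *
        (1 - Real.exp (-t / 2))⁻¹ := by
  have hq1 : ‖q‖ < 1 := by rw [hq]; simpa using ht
  have h1 : Real.exp (-t / 2) < 1 := by rw [Real.exp_lt_one_iff]; linarith
  rw [genFun_eq hq1]
  exact tsum_of_norm_bounded ((hasSum_geometric_of_lt_one (Real.exp_pos _).le h1).mul_left _)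
    (norm_partTerm_le_exp ht hq)

/-! ### The distance from q to 1 outside the cone, and the bound (ii). -/

lemma eventually_mul_le_of_hasDerivAt {f : ℝ → ℝ} {f' c : ℝ} (hf : HasDerivAt f f' 0) (h0 : f 0 = 0)
    (hc : c < f') : ∀ᶠ t in 𝓝[>] 0, c * t ≤ f t := by
  have h1 := (hasDerivAt_iff_tendsto_slope.mp hf).mono_left
    (nhdsWithin_mono 0 (fun x (hx : 0 < x) => hx.ne'))
  filter_upwards [h1.eventually (lt_mem_nhds hc), self_mem_nhdsWithin] with t ht ht0
  rw [slope_def_field, h0, sub_zero, sub_zero, lt_div_iff₀ ht0] at ht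
  exact ht.le

lemma norm_nome (x y : ℝ) : ‖nome (x + y * Complex.I)‖ = Real.exp (-(2 * Real.pi * y)) := by
  rw [nome, Complex.norm_exp]
  simp

lemma sq_norm_one_sub_nome (x y : ℝ) : ‖1 - nome (x + y * Complex.I)‖ ^ 2 =
    (1 - Real.exp (-(2 * Real.pi * y))) ^ 2 +
      (2 * Real.exp (-(2 * Real.pi * y) / 2) * Real.sin (Real.pi * x)) ^ 2 := by
  have h1 : 2 * Real.pi * Complex.I * (x + y * Complex.I) =
      ((-(2 * Real.pi * y) : ℝ) : ℂ) + ((2 * (Real.pi * x) : ℝ) : ℂ) * Complex.I := by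
    push_cast
    linear_combination 2 * Real.pi * y * Complex.I_sq
  have h2 : Real.exp (-(2 * Real.pi * y) / 2) ^ 2 = Real.exp (-(2 * Real.pi * y)) := by
    rw [← Real.exp_nat_mul]; congr 1; push_cast; ring
  have hre : (nome (x + y * Complex.I)).re =
      Real.exp (-(2 * Real.pi * y)) * Real.cos (2 * (Real.pi * x)) := by
    rw [nome, h1, Complex.exp_re]; simp
  have him : (nome (x + y * Complex.I)).im =
      Real.exp (-(2 * Real.pi * y)) * Real.sin (2 * (Real.pi * x)) := by
    rw [nome, h1, Complex.exp_im]; simp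
  rw [Complex.sq_norm, Complex.normSq_apply, Complex.sub_re, Complex.sub_im, hre, him,
    Real.cos_two_mul, Real.sin_two_mul]
  simp only [Complex.one_re, Complex.one_im]
  rw [mul_pow, mul_pow, h2]
  have h3 := Real.sin_sq_add_cos_sq (Real.pi * x)
  generalize Real.exp (-(2 * Real.pi * y)) = r
  generalize Real.sin (Real.pi * x) = s at *
  generalize Real.cos (Real.pi * x) = c at *
  have h4 : s ^ 2 = 1 - c ^ 2 := by linarith
  linear_combination (4 * r ^ 2 * c ^ 2 - 4 * r) * h4

/-- In |1 - q|² = (1 - e^{-2πy})² + (2e^{-πy} sin πx)², monotonicity of sine reduces |x| to My. The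
two bases then have derivatives 2π and 2πM at y = 0, so any κ < 1 works for small y. -/
lemma exists_norm_one_sub_nome_ge {M κ : ℝ} (hM : 0 < M) (hκ0 : 0 < κ) (hκ : κ < 1) :
    ∃ y₀ : ℝ, 0 < y₀ ∧ ∀ x y : ℝ, 0 < y → y < y₀ → M * y < |x| → |x| ≤ 1 / 2 →
      κ * (2 * Real.pi * y) * √(1 + M ^ 2) ≤ ‖1 - nome (x + y * Complex.I)‖ := by
  have hpi := Real.pi_pos
  have h1 : HasDerivAt (fun y : ℝ => 1 - Real.exp (-(2 * Real.pi * y))) (2 * Real.pi) 0 := by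
    have h := (((hasDerivAt_id (0 : ℝ)).const_mul (2 * Real.pi)).fun_neg.exp).const_sub 1
    exact h.congr_deriv (by simp)
  have h2 : HasDerivAt (fun y : ℝ => 2 * Real.exp (-(2 * Real.pi * y) / 2) *
      Real.sin (Real.pi * (M * y))) (2 * Real.pi * M) 0 := by
    have ha := (((((hasDerivAt_id (0 : ℝ)).const_mul (2 * Real.pi)).fun_neg).div_const
      2).exp).const_mul 2
    have hb := (((hasDerivAt_id (0 : ℝ)).const_mul M).const_mul Real.pi).sin
    have h := ha.mul hb
    exact h.congr_deriv (by simp; ring)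
  have e1 := eventually_mul_le_of_hasDerivAt h1 (by simp) (c := κ * (2 * Real.pi))
    (by nlinarith)
  have e2 := eventually_mul_le_of_hasDerivAt h2 (by simp) (c := κ * (2 * Real.pi * M))
    (by nlinarith [mul_pos hpi hM])
  obtain ⟨y₀, hy₀, H⟩ := mem_nhdsGT_iff_exists_Ioo_subset.mp (e1.and e2)
  refine ⟨y₀, hy₀, fun x y hy0 hy hx hx2 => ?_⟩
  obtain ⟨g1, g2⟩ := H ⟨hy0, hy⟩
  refine (sq_le_sq₀ (by positivity) (norm_nonneg _)).mp ?_
  rw [sq_norm_one_sub_nome, mul_pow, Real.sq_sqrt (by positivity)]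
  have hsin : Real.sin (Real.pi * (M * y)) ≤ Real.sin (Real.pi * |x|) := by
    refine Real.sin_le_sin_of_le_of_le_pi_div_two ?_ ?_ (by gcongr)
    · have : 0 ≤ Real.pi * (M * y) := by positivity
      linarith
    · nlinarith
  have hsq : Real.sin (Real.pi * x) ^ 2 = Real.sin (Real.pi * |x|) ^ 2 := by
    rcases abs_cases x with ⟨h, _⟩ | ⟨h, _⟩ <;> rw [h]
    rw [mul_neg, Real.sin_neg, neg_sq]
  have g3 : κ * (2 * Real.pi * M) * y ≤
      2 * Real.exp (-(2 * Real.pi * y) / 2) * Real.sin (Real.pi * |x|) :=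
    g2.trans (mul_le_mul_of_nonneg_left hsin (by positivity))
  have g4 := pow_le_pow_left₀ (by positivity) g3 2
  have g5 := pow_le_pow_left₀ (by positivity) g1 2
  rw [mul_pow (2 * Real.exp _), ← hsq, ← mul_pow] at g4
  calc _ = (κ * (2 * Real.pi) * y) ^ 2 + (κ * (2 * Real.pi * M) * y) ^ 2 := by ring
    _ ≤ _ := add_le_add g5 g4

lemma norm_genFun_minor_arc {M : ℝ} (hM : 0 < M) :
    ∃ C : ℝ, ∃ y₀ : ℝ, 0 < y₀ ∧ ∀ (x y : ℝ) (τ : ℂ), τ = x + y * Complex.I →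
        0 < y → y < y₀ → M * y < |x| → |x| ≤ 1 / 2 →
        ‖genFun (nome τ)‖ ≤
          C * (1 / (y * Real.sqrt 2) * Real.exp (1 / y *
            (Real.pi / 8 - 1 / Real.pi * (1 - 1 / Real.sqrt (1 + M ^ 2))))) := by
  have hpi := Real.pi_pos
  -- With this κ the loss in 2/|1 - q| is at most 1/(200t), half of the margin 1/(100t) in
  -- `norm_genFun_le`.
  obtain ⟨y₁, hy₁, H⟩ := exists_norm_one_sub_nome_ge hM (κ := 400 / 401) (by norm_num) (by norm_num)
  refine ⟨1280000, min y₁ (1 / 10), by positivity, fun x y τ hτ hy0 hy hx hx2 => ?_⟩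
  subst hτ
  have hy1 : y < y₁ := hy.trans_le (min_le_left _ _)
  have hy2 : y < 1 / 10 := hy.trans_le (min_le_right _ _)
  set t := 2 * Real.pi * y with ht
  have ht0 : 0 < t := by positivity
  have ht1 : t ≤ 1 := by
    have : Real.pi < 3.15 := Real.pi_lt_d2
    nlinarith
  have hL : 1 ≤ √(1 + M ^ 2) := by
    rw [Real.one_le_sqrt]; nlinarith
  set L := √(1 + M ^ 2)
  have h1 := norm_genFun_le ht0 (norm_nome x y)
  have h2 := H x y hy0 hy1 hx hx2
  have h3 : 2 / ‖1 - nome (x + y * Complex.I)‖ ≤ 1 / t * (2 / L + 1 / 200) := by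
    calc 2 / ‖1 - nome (x + y * Complex.I)‖ ≤ 2 / (400 / 401 * t * L) := by gcongr
      _ = 1 / t * (2 / L + 1 / 200 / L) := by field_simp; norm_num
      _ ≤ 1 / t * (2 / L + 1 / 200) := by
        have : 1 / 200 / L ≤ 1 / 200 := div_le_self (by norm_num) hL
        exact mul_le_mul_of_nonneg_left (by linarith) (by positivity)
  have hlow : ∀ s : ℝ, 0 ≤ s → s ≤ 1 → s / 2 ≤ 1 - Real.exp (-s) := fun s hs hs1 => by
    have h := Real.add_one_le_exp s
    have h' : Real.exp s * Real.exp (-s) = 1 := by rw [← Real.exp_add]; simp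
    have h'' := mul_le_mul_of_nonneg_right h (Real.exp_pos (-s)).le
    nlinarith
  have h4 : 2 / (1 - Real.exp (-t)) ≤ 2 / (t / 2) := by
    gcongr
    exact hlow t ht0.le ht1
  have h5 : (1 - Real.exp (-t / 2))⁻¹ ≤ (t / 2 / 2)⁻¹ := by
    gcongr
    have := hlow (t / 2) (by positivity) (by linarith)
    rwa [← neg_div] at this
  have h6 : 0 ≤ (1 - Real.exp (-t / 2))⁻¹ := by
    rw [inv_nonneg, sub_nonneg, Real.exp_le_one_iff]; linarith
  -- The other half of the margin absorbs the factor 16/t²: e^{-s} ≤ 2/s² at s = 1/(200t).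
  have h7 : Real.exp (-(1 / (200 * t))) ≤ 80000 * t ^ 2 := by
    have h := Real.quadratic_le_exp_of_nonneg (x := 1 / (200 * t)) (by positivity)
    have h' : Real.exp (1 / (200 * t)) * Real.exp (-(1 / (200 * t))) = 1 := by
      rw [← Real.exp_add]; simp
    have h8 : (1 / (200 * t)) ^ 2 / 2 ≤ Real.exp (1 / (200 * t)) := by
      have : 0 ≤ 1 / (200 * t) := by positivity
      linarith
    have h9 := mul_le_mul_of_nonneg_right h8 (Real.exp_pos (-(1 / (200 * t)))).le
    rw [h'] at h9
    have h10 : 80000 * t ^ 2 * ((1 / (200 * t)) ^ 2 / 2) = 1 := by field_simp; norm_num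
    nlinarith [mul_le_mul_of_nonneg_left h9 (show 0 ≤ 80000 * t ^ 2 by positivity)]
  have h8 : 1 / t * (Real.pi ^ 2 / 4 - 2 - 1 / 100) + 1 / t * (2 / L + 1 / 200) =
      1 / y * (Real.pi / 8 - 1 / Real.pi * (1 - 1 / L)) + -(1 / (200 * t)) := by
    rw [ht]; field_simp; ring
  have h9 : (1 : ℝ) ≤ 1 / (y * √2) := by
    rw [le_div_iff₀ (by positivity)]
    have : √2 ≤ 2 := Real.sqrt_le_iff.mpr (by norm_num)
    nlinarith [Real.sqrt_nonneg 2]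
  set E := Real.exp (1 / y * (Real.pi / 8 - 1 / Real.pi * (1 - 1 / L))) with hE
  calc ‖genFun (nome (x + y * Complex.I))‖
      ≤ 2 / (1 - Real.exp (-t)) * Real.exp (1 / t * (Real.pi ^ 2 / 4 - 2 - 1 / 100) +
        2 / ‖1 - nome (x + y * Complex.I)‖) * (1 - Real.exp (-t / 2))⁻¹ := h1
    _ ≤ 2 / (t / 2) * Real.exp (1 / t * (Real.pi ^ 2 / 4 - 2 - 1 / 100) +
        1 / t * (2 / L + 1 / 200)) * (t / 2 / 2)⁻¹ := by gcongr
    _ = 16 / t ^ 2 * (E * Real.exp (-(1 / (200 * t)))) := by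
        rw [h8, Real.exp_add, ← hE]; clear_value E; field_simp; ring
    _ ≤ 16 / t ^ 2 * (E * (80000 * t ^ 2)) := by gcongr
    _ = 1280000 * (1 * E) := by clear_value E; field_simp; ring
    _ ≤ _ := by gcongr

end OddEvenOverpartition

namespace OddEvenOverpartition

/-! ### The Appell sum near the dominant singularity -/

/-- Cauchy's theorem on the rectangle over [-T, T]; the Gaussian bound kills the vertical sides as T
→ ∞. -/
lemma integral_horizontal_shift {F : ℂ → ℂ} {η K b : ℝ} (hη : 0 ≤ η) (hb : 0 < b)
    (hd : ∀ x y : ℝ, 0 ≤ y → y ≤ η → DifferentiableAt ℂ F (x + y * Complex.I))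
    (hF : ∀ x y : ℝ, 0 ≤ y → y ≤ η → ‖F (x + y * Complex.I)‖ ≤ K * Real.exp (-b * x ^ 2)) :
    ∫ x : ℝ, F x = ∫ x : ℝ, F (x + η * Complex.I) := by
  have hcont : ∀ y : ℝ, 0 ≤ y → y ≤ η → Continuous fun x : ℝ => F (x + y * Complex.I) :=
    fun y h0 h1 => continuous_iff_continuousAt.mpr fun x =>
      ContinuousAt.comp (f := fun x : ℝ => (x + y * Complex.I : ℂ)) (hd x y h0 h1).continuousAt
        (by fun_prop)
  have hint : ∀ y : ℝ, 0 ≤ y → y ≤ η →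
      MeasureTheory.Integrable fun x : ℝ => F (x + y * Complex.I) := fun y h0 h1 =>
    ((integrable_exp_neg_mul_sq hb).const_mul K).mono' (hcont y h0 h1).aestronglyMeasurable
      (Eventually.of_forall fun x => hF x y h0 h1)
  have l1 := MeasureTheory.intervalIntegral_tendsto_integral (hint 0 le_rfl hη)
    tendsto_neg_atTop_atBot tendsto_id
  have l2 := MeasureTheory.intervalIntegral_tendsto_integral (hint η hη le_rfl)
    tendsto_neg_atTop_atBot tendsto_id
  have hside : ∀ s : ℝ, ∀ T : ℝ, s ^ 2 = T ^ 2 →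
      ‖∫ y in (0 : ℝ)..η, F (s + y * Complex.I)‖ ≤ K * Real.exp (-b * T ^ 2) * |η - 0| := by
    intro s T hs
    refine intervalIntegral.norm_integral_le_of_norm_le_const fun y hy => ?_
    rw [Set.uIoc_of_le hη] at hy
    rw [← hs]
    exact hF s y hy.1.le hy.2
  have hlim : Tendsto (fun T : ℝ => K * Real.exp (-b * T ^ 2) * |η - 0|) atTop (𝓝 0) := by
    have h1 : Tendsto (fun T : ℝ => -b * T ^ 2) atTop atBot :=
      (tendsto_pow_atTop two_ne_zero).const_mul_atTop_of_neg (by linarith)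
    simpa using ((Real.tendsto_exp_atBot.comp h1).const_mul K).mul_const |η - 0|
  have l3 : Tendsto (fun T : ℝ => ∫ y in (0 : ℝ)..η, F ((T : ℝ) + y * Complex.I)) atTop (𝓝 0) :=
    squeeze_zero_norm (fun T => hside T T rfl) hlim
  have l4 : Tendsto (fun T : ℝ => ∫ y in (0 : ℝ)..η, F ((-T : ℝ) + y * Complex.I)) atTop (𝓝 0) :=
    squeeze_zero_norm (fun T => hside (-T) T (by ring)) hlim
  have key : ∀ T : ℝ, (∫ x in (-T)..T, F (x + (0 : ℝ) * Complex.I)) -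
      (∫ x in (-T)..T, F (x + η * Complex.I)) +
      Complex.I • (∫ y in (0 : ℝ)..η, F ((T : ℝ) + y * Complex.I)) -
      Complex.I • (∫ y in (0 : ℝ)..η, F ((-T : ℝ) + y * Complex.I)) = 0 := by
    intro T
    have h := Complex.integral_boundary_rect_eq_zero_of_differentiableOn F
      ((-T : ℝ) : ℂ) ((T : ℝ) + η * Complex.I) ?_
    · simpa using h
    · intro z hz
      have him : z.im ∈ Set.uIcc 0 η := by simpa using hz.2
      rw [Set.uIcc_of_le hη] at him
      have := hd z.re z.im him.1 him.2
      rw [Complex.re_add_im] at this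
      exact this.differentiableWithinAt
  have l5 := ((l1.sub l2).add (l3.const_smul Complex.I)).sub (l4.const_smul Complex.I)
  simp only [id] at l5
  rw [tendsto_congr key] at l5
  have := tendsto_nhds_unique l5 tendsto_const_nhds
  simp only [smul_zero, add_zero, sub_zero, Complex.ofReal_zero, zero_mul] at this
  exact sub_eq_zero.mp this

/-- The lower bound for `cosh` used in a cone of aperture `M`. -/
noncomputable def coshBound (M : ℝ) : ℝ := min (1 / 2) (Real.pi / (6 * M))

lemma coshBound_pos {M : ℝ} (hM : 0 < M) : 0 < coshBound M := by
  have := Real.pi_pos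
  unfold coshBound
  positivity

/-- Use |cosh(a + ic)|² = sinh² a + cos² c with c = b + θ. If |b| ≤ π/6, then |c| ≤ π/3 and the
cosine is at least 1/2; otherwise the cone condition |b| ≤ M|a| makes |sinh a| ≥ |a| large. -/
lemma coshBound_le_norm_cosh {M : ℝ} (hM : 0 < M) {w : ℂ} (hw : |w.im| ≤ M * w.re) (σ : ℝ)
    {θ : ℝ} (hθ : |θ| ≤ Real.pi / 6) :
    coshBound M ≤ ‖Complex.cosh (w * σ / 2 + θ * Complex.I)‖ := by
  have hpi := Real.pi_pos
  set a := w.re * σ / 2 with ha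
  set b := w.im * σ / 2 with hb
  have e : w * σ / 2 + θ * Complex.I = (a : ℂ) + ((b + θ : ℝ) : ℂ) * Complex.I := by
    apply Complex.ext <;> simp [ha, hb]
  have hsq : ‖Complex.cosh (w * σ / 2 + θ * Complex.I)‖ ^ 2 =
      Real.sinh a ^ 2 + Real.cos (b + θ) ^ 2 := by
    rw [e]
    generalize b + θ = c
    rw [Complex.cosh_add, Complex.cosh_mul_I, Complex.sinh_mul_I, ← Complex.ofReal_cosh,
      ← Complex.ofReal_sinh, ← Complex.ofReal_cos, ← Complex.ofReal_sin, Complex.sq_norm,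
      Complex.normSq_apply]
    simp [Complex.cos_ofReal_re, Complex.sin_ofReal_re, Complex.sinh_ofReal_re]
    have h1 := Real.cosh_sq a
    have h2 := Real.sin_sq_add_cos_sq c
    linear_combination Real.cos c ^ 2 * h1 + Real.sinh a ^ 2 * h2
  refine (sq_le_sq₀ (coshBound_pos hM).le (norm_nonneg _)).mp ?_
  rw [hsq]
  by_cases hcase : |b| ≤ Real.pi / 6
  · have h1 : |b + θ| ≤ Real.pi / 3 := (abs_add_le b θ).trans (by linarith)
    have h2 : 1 / 2 ≤ Real.cos (b + θ) := by
      rw [← Real.cos_abs, ← Real.cos_pi_div_three]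
      exact Real.cos_le_cos_of_nonneg_of_le_pi (abs_nonneg _) (by linarith) h1
    have h3 : coshBound M ≤ Real.cos (b + θ) := (min_le_left _ _).trans h2
    have := pow_le_pow_left₀ (coshBound_pos hM).le h3 2
    nlinarith [sq_nonneg (Real.sinh a)]
  · push Not at hcase
    have h1 : |b| ≤ M * |a| := by
      have hre : 0 ≤ w.re := by
        by_contra h
        push Not at h
        have := abs_nonneg w.im
        nlinarith
      rw [ha, hb, abs_div, abs_mul, abs_div, abs_mul, abs_of_nonneg hre]
      calc |w.im| * |σ| / |2| ≤ M * w.re * |σ| / |2| := by gcongr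
        _ = _ := by ring
    have h2 : Real.pi / (6 * M) ≤ |a| := by
      rw [div_le_iff₀ (by positivity)]
      nlinarith
    have h3 : |a| ≤ |Real.sinh a| := by
      rw [Real.abs_sinh]
      exact Real.self_le_sinh_iff.mpr (abs_nonneg a)
    have h4 : coshBound M ≤ |Real.sinh a| := (min_le_right _ _).trans (h2.trans h3)
    have := pow_le_pow_left₀ (coshBound_pos hM).le h4 2
    rw [sq_abs] at this
    nlinarith [sq_nonneg (Real.cos (b + θ))]

/-- The functions whose integrals over the real line are the Fourier coefficients of the
Appell sum. -/
noncomputable def kernel (w : ℂ) (k : ℝ) (z : ℂ) : ℂ :=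
  Complex.exp (-(3 / 2) * w * z ^ 2 + Real.pi * k * z * Complex.I) / Complex.cosh (w * z / 2)

section
variable {M : ℝ} {w : ℂ} (hM : 0 < M) (hw0 : 0 < w.re) (hw : |w.im| ≤ M * w.re)

/-- A point of the strip is written in the real directions 1 and i/w, in which wz/2 has the shape
required by `coshBound_le_norm_cosh`. The height |y| ≤ π Re w/(3|w|²) = Im(πi/(3w)) corresponds to
|θ| ≤ π/6. -/
lemma strip_eq (hw0 : 0 < w.re) (x y : ℝ) :
    w * (x + y * Complex.I) / 2 =
      w * ((x - y * w.im / w.re : ℝ) : ℂ) / 2 +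
        ((y * ‖w‖ ^ 2 / (2 * w.re) : ℝ) : ℂ) * Complex.I := by
  have h1 : y * ‖w‖ ^ 2 / (2 * w.re) = y * w.re / 2 + w.im * (y * w.im / w.re) / 2 := by
    rw [Complex.sq_norm, Complex.normSq_apply]
    field_simp
  have h2 : w.re * (y * w.im / w.re) = y * w.im := by field_simp
  rw [h1]
  generalize y * w.im / w.re = B at *
  apply Complex.ext
  · simp; linarith
  · simp; ring

include hM hw0 hw in
lemma coshBound_le_strip (x : ℝ) {y : ℝ} (hy : |y| ≤ Real.pi * w.re / (3 * ‖w‖ ^ 2)) :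
    coshBound M ≤ ‖Complex.cosh (w * (x + y * Complex.I) / 2)‖ := by
  rw [strip_eq hw0]
  refine coshBound_le_norm_cosh hM hw _ ?_
  have hn : 0 < ‖w‖ := norm_pos_iff.mpr (by rintro rfl; simp at hw0)
  rw [abs_div, abs_mul, abs_of_pos (show 0 < 2 * w.re by positivity),
    abs_of_pos (show 0 < ‖w‖ ^ 2 by positivity), div_le_iff₀ (by positivity)]
  rw [le_div_iff₀ (by positivity)] at hy
  linarith

include hM hw0 hw in
lemma cosh_strip_ne_zero (x : ℝ) {y : ℝ} (hy : |y| ≤ Real.pi * w.re / (3 * ‖w‖ ^ 2)) :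
    Complex.cosh (w * (x + y * Complex.I) / 2) ≠ 0 :=
  norm_pos_iff.mp ((coshBound_pos hM).trans_le (coshBound_le_strip hM hw0 hw x hy))

include hM hw0 hw in
lemma exists_norm_kernel_le (k : ℝ) :
    ∃ K : ℝ, ∀ x y : ℝ, |y| ≤ Real.pi * w.re / (3 * ‖w‖ ^ 2) →
      ‖kernel w k (x + y * Complex.I)‖ ≤ K * Real.exp (-w.re * x ^ 2) := by
  set Y := Real.pi * w.re / (3 * ‖w‖ ^ 2) with hY
  set t := w.re with ht
  set v := w.im with hv
  refine ⟨Real.exp (9 * v ^ 2 * Y ^ 2 / (2 * t) + 3 / 2 * t * Y ^ 2 + Real.pi * |k| * Y) *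
    (coshBound M)⁻¹, fun x y hy => ?_⟩
  have hpi := Real.pi_pos
  rw [kernel, norm_div, Complex.norm_exp, div_eq_mul_inv, mul_right_comm (Real.exp _),
    ← Real.exp_add]
  have h1 := coshBound_le_strip hM hw0 hw x hy
  have h2 := coshBound_pos hM
  have hre : (-(3 / 2) * w * (x + y * Complex.I) ^ 2 +
      Real.pi * k * (x + y * Complex.I) * Complex.I).re =
      -(3 / 2) * t * (x ^ 2 - y ^ 2) + 3 * v * (x * y) - Real.pi * k * y := by
    simp [sq, ht, hv]
    ring
  gcongr
  rw [hre]
  have hY2 : y ^ 2 ≤ Y ^ 2 := by rw [← sq_abs y]; exact pow_le_pow_left₀ (abs_nonneg _) hy 2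
  -- Completing the square costs t x²/2 of the available 3t x²/2, which leaves the decay e^{-t x²}.
  have g1 : 3 * v * (x * y) ≤ 9 * v ^ 2 * Y ^ 2 / (2 * t) + t / 2 * x ^ 2 := by
    have : 3 * v * (x * y) ≤ 9 * v ^ 2 * y ^ 2 / (2 * t) + t / 2 * x ^ 2 := by
      have e : 9 * v ^ 2 * y ^ 2 / (2 * t) + t / 2 * x ^ 2 - 3 * v * (x * y) =
          (3 * v * y - t * x) ^ 2 / (2 * t) := by field_simp; ring
      have : 0 ≤ (3 * v * y - t * x) ^ 2 / (2 * t) := by positivity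
      linarith
    refine this.trans ?_
    gcongr
  have g2 : -(Real.pi * k * y) ≤ Real.pi * |k| * Y := by
    calc -(Real.pi * k * y) ≤ |-(Real.pi * k * y)| := le_abs_self _
      _ = Real.pi * |k| * |y| := by rw [abs_neg, abs_mul, abs_mul, abs_of_pos hpi]
      _ ≤ _ := by gcongr
  nlinarith

include hM hw0 hw in
lemma differentiableAt_kernel (k x : ℝ) {y : ℝ} (hy : |y| ≤ Real.pi * w.re / (3 * ‖w‖ ^ 2)) :
    DifferentiableAt ℂ (kernel w k) (x + y * Complex.I) := by
  have := cosh_strip_ne_zero hM hw0 hw x hy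
  unfold kernel
  fun_prop (disch := exact this)

-- The imaginary part of the shift πi/(3w) is a contour move inside the pole-free strip; its real
-- part is a translation of the line.
include hM hw0 hw in
lemma integral_kernel_shift (k : ℝ) :
    ∫ x : ℝ, kernel w k x = ∫ x : ℝ, kernel w k (x + Real.pi * Complex.I / (3 * w)) := by
  obtain ⟨K, hK⟩ := exists_norm_kernel_le hM hw0 hw k
  set Y := Real.pi * w.re / (3 * ‖w‖ ^ 2) with hY
  have hpi := Real.pi_pos
  have hY0 : 0 ≤ Y := by positivity
  have hn : w ≠ 0 := by rintro rfl; simp at hw0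
  have habs : ∀ y : ℝ, 0 ≤ y → y ≤ Y → |y| ≤ Y := fun y h0 h1 => by rwa [abs_of_nonneg h0]
  rw [integral_horizontal_shift hY0 hw0
    (fun x y h0 h1 => differentiableAt_kernel hM hw0 hw k x (habs y h0 h1))
    (fun x y h0 h1 => hK x y (habs y h0 h1))]
  rw [← MeasureTheory.integral_add_right_eq_self (fun x : ℝ => kernel w k (x + Y * Complex.I))
    (Real.pi * w.im / (3 * ‖w‖ ^ 2))]
  congr 1
  ext x
  congr 1
  have h1 : (w.re + w.im * Complex.I) * (w.re - w.im * Complex.I) = ((‖w‖ ^ 2 : ℝ) : ℂ) := by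
    rw [Complex.sq_norm, Complex.normSq_apply]
    push_cast
    linear_combination -(w.im : ℂ) ^ 2 * Complex.I_sq
  rw [Complex.re_add_im] at h1
  have h2 : ((‖w‖ ^ 2 : ℝ) : ℂ) ≠ 0 := by
    rw [Complex.ofReal_ne_zero]; positivity
  have h3 : Real.pi * Complex.I / (3 * w) =
      Real.pi * Complex.I * (w.re - w.im * Complex.I) / (3 * ((‖w‖ ^ 2 : ℝ) : ℂ)) := by
    rw [← h1]
    have : (w.re : ℂ) - w.im * Complex.I ≠ 0 := by
      intro h; rw [h, mul_zero] at h1; exact h2 h1.symm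
    rw [← mul_assoc, mul_div_mul_right _ _ this]
  rw [h3, hY]
  push_cast
  linear_combination (Real.pi * w.im / (3 * (‖w‖ : ℂ) ^ 2)) * Complex.I_sq

end

end OddEvenOverpartition

/-! ### Poisson summation and the saddle-point evaluation. -/

namespace OddEvenOverpartition

/-- Averaging over ±ζ removes the linear term. The difference equals (1 - cosh ζ)(4 cosh ζ +
1)/(2√3·AB), quadratic for small ζ; for |ζ| ≥ 1 a crude bound suffices. -/
lemma norm_even_part_sub_le {κ : ℝ} (hκ : 0 < κ) {ζ : ℂ}
    (h1 : κ ≤ ‖Complex.cosh (ζ + ((Real.pi / 6 : ℝ) : ℂ) * Complex.I)‖)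
    (h2 : κ ≤ ‖Complex.cosh (-ζ + ((Real.pi / 6 : ℝ) : ℂ) * Complex.I)‖) :
    ‖((Complex.cosh (ζ + ((Real.pi / 6 : ℝ) : ℂ) * Complex.I))⁻¹ +
      (Complex.cosh (-ζ + ((Real.pi / 6 : ℝ) : ℂ) * Complex.I))⁻¹) / 2 - 2 / (√3 : ℂ)‖ ≤
      (3 / κ ^ 2 + 1 / κ + 2) * ‖ζ‖ ^ 2 := by
  have hs3 : (√3 : ℝ) ^ 2 = 3 := Real.sq_sqrt (by norm_num)
  have hs3' : ((√3 : ℝ) : ℂ) ^ 2 = 3 := by exact_mod_cast hs3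
  have hs1 : (3 / 2 : ℝ) ≤ √3 := Real.le_sqrt_of_sq_le (by norm_num)
  have hsne : ((√3 : ℝ) : ℂ) ≠ 0 := by
    rw [Complex.ofReal_ne_zero]; positivity
  have hA : Complex.cosh (ζ + ((Real.pi / 6 : ℝ) : ℂ) * Complex.I) =
      Complex.cosh ζ * (√3 / 2) + Complex.sinh ζ * (1 / 2 * Complex.I) := by
    rw [Complex.cosh_add, Complex.cosh_mul_I, Complex.sinh_mul_I, ← Complex.ofReal_cos,
      ← Complex.ofReal_sin, Real.cos_pi_div_six, Real.sin_pi_div_six]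
    push_cast; ring
  have hB : Complex.cosh (-ζ + ((Real.pi / 6 : ℝ) : ℂ) * Complex.I) =
      Complex.cosh ζ * (√3 / 2) - Complex.sinh ζ * (1 / 2 * Complex.I) := by
    rw [Complex.cosh_add, Complex.cosh_mul_I, Complex.sinh_mul_I, ← Complex.ofReal_cos,
      ← Complex.ofReal_sin, Real.cos_pi_div_six, Real.sin_pi_div_six, Complex.cosh_neg,
      Complex.sinh_neg]
    push_cast; ring
  set A := Complex.cosh (ζ + ((Real.pi / 6 : ℝ) : ℂ) * Complex.I)
  set B := Complex.cosh (-ζ + ((Real.pi / 6 : ℝ) : ℂ) * Complex.I)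
  have hA0 : A ≠ 0 := norm_pos_iff.mp (hκ.trans_le h1)
  have hB0 : B ≠ 0 := norm_pos_iff.mp (hκ.trans_le h2)
  have hsq := Complex.cosh_sq ζ
  have hAB : A * B = Complex.cosh ζ ^ 2 - 1 / 4 := by
    rw [hA, hB]
    linear_combination Complex.cosh ζ ^ 2 / 4 * hs3' - Complex.sinh ζ ^ 2 / 4 * Complex.I_sq -
      1 / 4 * hsq
  have hsum : A + B = √3 * Complex.cosh ζ := by rw [hA, hB]; ring
  have hdiff : (A⁻¹ + B⁻¹) / 2 - 2 / (√3 : ℂ) =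
      (1 - Complex.cosh ζ) * (4 * Complex.cosh ζ + 1) / (2 * √3 * (A * B)) := by
    have : (A⁻¹ + B⁻¹) / 2 - 2 / (√3 : ℂ) = ((A + B) * √3 - 4 * (A * B)) / (2 * √3 * (A * B)) := by
      field_simp
      ring
    rw [this, hsum, hAB]
    congr 1
    linear_combination Complex.cosh ζ * hs3'
  have hABn : κ ^ 2 ≤ ‖A * B‖ := by
    rw [norm_mul, sq]
    exact mul_le_mul h1 h2 hκ.le (norm_nonneg _)
  rcases le_total ‖ζ‖ 1 with hζ | hζ
  · have hc : ‖Complex.cosh ζ - 1‖ ≤ ‖ζ‖ ^ 2 := by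
      have e1 := Complex.norm_exp_sub_one_sub_id_le hζ
      have e2 := Complex.norm_exp_sub_one_sub_id_le (x := -ζ) (by simpa using hζ)
      rw [norm_neg] at e2
      have : Complex.cosh ζ - 1 =
          ((Complex.exp ζ - 1 - ζ) + (Complex.exp (-ζ) - 1 - -ζ)) / 2 := by
        rw [Complex.cosh]; ring
      rw [this, norm_div, Complex.norm_ofNat]
      have := norm_add_le (Complex.exp ζ - 1 - ζ) (Complex.exp (-ζ) - 1 - -ζ)
      linarith
    have hc1 : ‖Complex.cosh ζ‖ ≤ 2 := by
      have := norm_le_norm_add_norm_sub' (Complex.cosh ζ) 1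
      rw [norm_one] at this
      nlinarith [norm_nonneg ζ]
    have hc2 : ‖4 * Complex.cosh ζ + 1‖ ≤ 9 := by
      refine (norm_add_le _ _).trans ?_
      rw [norm_mul, Complex.norm_ofNat, norm_one]
      linarith
    rw [hdiff, norm_div, norm_mul, norm_sub_rev, norm_mul, norm_mul, Complex.norm_ofNat,
      Complex.norm_real, Real.norm_of_nonneg (Real.sqrt_nonneg 3)]
    calc ‖Complex.cosh ζ - 1‖ * ‖4 * Complex.cosh ζ + 1‖ / (2 * √3 * ‖A * B‖)
        ≤ ‖ζ‖ ^ 2 * 9 / (2 * (3 / 2) * κ ^ 2) := by gcongr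
      _ = 3 / κ ^ 2 * ‖ζ‖ ^ 2 := by field_simp; norm_num
      _ ≤ _ := by
        gcongr
        have : 0 < 1 / κ := by positivity
        linarith
  · have e1 : ‖A⁻¹‖ ≤ 1 / κ := by rw [norm_inv, ← one_div]; gcongr
    have e2 : ‖B⁻¹‖ ≤ 1 / κ := by rw [norm_inv, ← one_div]; gcongr
    have e3 : ‖2 / (√3 : ℂ)‖ ≤ 2 := by
      rw [norm_div, Complex.norm_ofNat, Complex.norm_real,
        Real.norm_of_nonneg (Real.sqrt_nonneg 3)]
      exact div_le_self (by norm_num) (by linarith)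
    have e4 : 1 ≤ ‖ζ‖ ^ 2 := one_le_pow₀ hζ
    calc ‖(A⁻¹ + B⁻¹) / 2 - 2 / (√3 : ℂ)‖ ≤ ‖(A⁻¹ + B⁻¹) / 2‖ + ‖2 / (√3 : ℂ)‖ := norm_sub_le _ _
      _ ≤ 1 / κ + 2 := by
        rw [norm_div, Complex.norm_ofNat]
        have := norm_add_le A⁻¹ B⁻¹
        linarith
      _ ≤ (3 / κ ^ 2 + 1 / κ + 2) * 1 := by
        have : 0 < 3 / κ ^ 2 := by positivity
        linarith
      _ ≤ _ := by gcongr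

/-- The point πi/(3w) is the saddle of the exponential for k = 1, where the oscillating factor
disappears. -/
lemma kernel_shift {w : ℂ} (hw : w ≠ 0) (k x : ℝ) :
    kernel w k (x + Real.pi * Complex.I / (3 * w)) =
      Complex.exp (-(Real.pi ^ 2 * (2 * k - 1) / 6 / w)) *
        (Complex.exp (-(3 / 2) * w * x ^ 2 + Real.pi * (k - 1) * x * Complex.I) *
          (Complex.cosh (w * x / 2 + ((Real.pi / 6 : ℝ) : ℂ) * Complex.I))⁻¹) := by
  rw [kernel, div_eq_mul_inv, ← mul_assoc, ← Complex.exp_add]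
  congr 2
  · field_simp
    linear_combination ((12 * k - 6) * Real.pi ^ 2 : ℂ) * Complex.I_sq
  · congr 1
    push_cast
    field_simp
    ring

lemma kernel_neg (w : ℂ) (k : ℝ) (z : ℂ) : kernel w (-k) (-z) = kernel w k z := by
  rw [kernel, kernel, show w * -z / 2 = -(w * z / 2) by ring, Complex.cosh_neg]
  congr 2
  push_cast
  ring

lemma integral_kernel_neg (w : ℂ) (k : ℝ) :
    ∫ x : ℝ, kernel w (-k) x = ∫ x : ℝ, kernel w k x := by
  rw [← MeasureTheory.integral_neg_eq_self]
  simp only [Complex.ofReal_neg, kernel_neg]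

lemma norm_exp_neg_div (a : ℝ) (w : ℂ) :
    ‖Complex.exp (-(a / w))‖ = Real.exp (-(a * (w.re / ‖w‖ ^ 2))) := by
  rw [Complex.norm_exp, Complex.neg_re, Complex.div_re, Complex.sq_norm]
  simp
  ring

section
variable {M : ℝ} {w : ℂ} (hM : 0 < M) (hw0 : 0 < w.re) (hw : |w.im| ≤ M * w.re)

-- The same shift serves every k, since for k = 3 the saddle kπi/(3w) already meets the pole πi/w.
-- It still gains e^{-π²(2k-1)/(6w)}, which is geometric in k.
include hM hw0 hw in
lemma norm_integral_kernel_le (k : ℝ) :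
    ‖∫ x : ℝ, kernel w k x‖ ≤ Real.exp (-(Real.pi ^ 2 * (2 * k - 1) / 6 * (w.re / ‖w‖ ^ 2))) *
      (√(Real.pi / (3 / 2 * w.re)) * (coshBound M)⁻¹) := by
  have hn : w ≠ 0 := by rintro rfl; simp at hw0
  rw [integral_kernel_shift hM hw0 hw]
  simp only [kernel_shift hn]
  rw [MeasureTheory.integral_const_mul, norm_mul]
  have e := norm_exp_neg_div (Real.pi ^ 2 * (2 * k - 1) / 6) w
  push_cast at e
  rw [e]
  gcongr
  have hint : MeasureTheory.Integrable fun x : ℝ => Real.exp (-(3 / 2 * w.re) * x ^ 2) :=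
    integrable_exp_neg_mul_sq (by positivity)
  refine (MeasureTheory.norm_integral_le_of_norm_le (hint.mul_const (coshBound M)⁻¹)
    (Eventually.of_forall fun x => ?_)).trans_eq ?_
  · rw [norm_mul, Complex.norm_exp, norm_inv]
    have h1 := coshBound_le_norm_cosh hM hw x (θ := Real.pi / 6)
      (by rw [abs_of_pos (by positivity)])
    have h2 := coshBound_pos hM
    gcongr
    simp [sq]
  · rw [MeasureTheory.integral_mul_const, integral_gaussian]

lemma fourier_kernel (w : ℂ) (m : ℝ) :
    FourierTransform.fourier (fun x : ℝ => kernel w 1 x) m = ∫ x : ℝ, kernel w (1 - 2 * m) x := by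
  rw [Real.fourier_real_eq_integral_exp_smul]
  congr 1
  ext x
  rw [smul_eq_mul, kernel, kernel, ← mul_div_assoc, ← Complex.exp_add]
  congr 2
  push_cast
  ring

include hM hw0 hw in
lemma norm_integral_kernel_odd_le (n : ℕ) :
    ‖∫ x : ℝ, kernel w (2 * n + 1) x‖ ≤
      Real.exp (-(Real.pi ^ 2 / 6 * (w.re / ‖w‖ ^ 2))) *
      (√(Real.pi / (3 / 2 * w.re)) * (coshBound M)⁻¹) *
        Real.exp (-(2 / 3 * Real.pi ^ 2 * (w.re / ‖w‖ ^ 2))) ^ n := by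
  refine (norm_integral_kernel_le hM hw0 hw (2 * n + 1)).trans_eq ?_
  rw [mul_right_comm, ← Real.exp_nat_mul, ← Real.exp_add]
  congr 2
  ring

include hM hw0 hw in
lemma summable_integral_kernel_odd : Summable fun n : ℕ => ∫ x : ℝ, kernel w (2 * n + 1) x := by
  have hn : 0 < ‖w‖ := norm_pos_iff.mpr (by rintro rfl; simp at hw0)
  refine Summable.of_norm_bounded ((summable_geometric_of_lt_one (Real.exp_pos _).le ?_).mul_left _)
    (norm_integral_kernel_odd_le hM hw0 hw)
  rw [Real.exp_lt_one_iff]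
  have := Real.pi_pos
  have : 0 < 2 / 3 * Real.pi ^ 2 * (w.re / ‖w‖ ^ 2) := by positivity
  linarith

-- The Fourier coefficient at m has frequency 1 - 2m, which runs through all odd integers, and
-- frequencies k and -k give equal integrals.
include hM hw0 hw in
lemma tsum_kernel_eq :
    ∑' n : ℤ, kernel w 1 n = 2 * ∑' n : ℕ, ∫ x : ℝ, kernel w (2 * n + 1) x := by
  have hpi := Real.pi_pos
  have hn : 0 < ‖w‖ := norm_pos_iff.mpr (by rintro rfl; simp at hw0)
  have hY0 : |(0 : ℝ)| ≤ Real.pi * w.re / (3 * ‖w‖ ^ 2) := by rw [abs_zero]; positivity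
  have hs := summable_integral_kernel_odd hM hw0 hw
  set S := ∑' n : ℕ, ∫ x : ℝ, kernel w (2 * n + 1) x with hS
  -- Negative m give the frequencies 3, 5, …, so the first integral is missing.
  have h1 : HasSum (fun n : ℕ => FourierTransform.fourier (fun x : ℝ => kernel w 1 x) (-((n : ℝ) + 1)))
      (S - ∫ x : ℝ, kernel w 1 x) := by
    have := (hasSum_nat_add_iff' 1).mpr hs.hasSum
    refine hasSum_of_eq this (fun n => ?_) ?_
    · rw [fourier_kernel]; push_cast; ring_nf
    · simp [hS]
  -- Nonnegative m give 1, -1, -3, …, so the first integral occurs twice.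
  have h2 : HasSum (fun n : ℕ => FourierTransform.fourier (fun x : ℝ => kernel w 1 x) (n : ℝ))
      (S + ∫ x : ℝ, kernel w 1 x) := by
    rw [← hasSum_nat_add_iff' 1]
    refine hasSum_of_eq hs.hasSum (fun n => ?_) ?_
    · rw [fourier_kernel, ← integral_kernel_neg]; push_cast; ring_nf
    · simp [fourier_kernel, hS]
  have h3 : HasSum (fun n : ℤ => FourierTransform.fourier (fun x : ℝ => kernel w 1 x) (n : ℝ))
      ((S + ∫ x : ℝ, kernel w 1 x) + (S - ∫ x : ℝ, kernel w 1 x)) := by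
    refine HasSum.of_nat_of_neg_add_one ?_ ?_
    · simpa using h2
    · simpa using h1
  have hc : Continuous fun x : ℝ => kernel w 1 x := continuous_iff_continuousAt.mpr fun x => by
    have := (differentiableAt_kernel hM hw0 hw 1 x hY0).continuousAt
    simp only [Complex.ofReal_zero, zero_mul, add_zero] at this
    exact ContinuousAt.comp (f := fun x : ℝ => (x : ℂ)) this (by fun_prop)
  have hdecay : (fun x : ℝ => kernel w 1 x) =O[cocompact ℝ] fun x : ℝ => |x| ^ (-2 : ℝ) := by
    obtain ⟨K, hK⟩ := exists_norm_kernel_le hM hw0 hw 1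
    refine Asymptotics.IsBigO.of_bound (|K| / w.re) ?_
    have : ∀ᶠ x : ℝ in cocompact ℝ, x ≠ 0 := by
      have := (isCompact_singleton (x := (0 : ℝ))).compl_mem_cocompact
      filter_upwards [this] with x hx using hx
    filter_upwards [this] with x hx
    have hb := hK x 0 hY0
    simp only [Complex.ofReal_zero, zero_mul, add_zero] at hb
    have hx2 : 0 < x ^ 2 := by positivity
    have e1 : ‖|x| ^ (-2 : ℝ)‖ = (x ^ 2)⁻¹ := by
      rw [Real.rpow_neg (abs_nonneg x), Real.rpow_two, sq_abs, Real.norm_of_nonneg (by positivity)]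
    rw [e1]
    refine hb.trans ?_
    have e2 : Real.exp (-w.re * x ^ 2) ≤ (w.re * x ^ 2)⁻¹ := by
      rw [neg_mul, Real.exp_neg]
      have := Real.add_one_le_exp (w.re * x ^ 2)
      gcongr
      linarith
    calc K * Real.exp (-w.re * x ^ 2) ≤ |K| * (w.re * x ^ 2)⁻¹ := by
          gcongr
          exact le_abs_self K
      _ = _ := by rw [mul_inv]; ring
  have h4 := Real.tsum_eq_tsum_fourier_of_rpow_decay_of_summable hc one_lt_two hdecay h3.summable 0
  simp only [zero_add] at h4
  rw [tsum_congr (fun n : ℤ => by rw [Complex.ofReal_intCast])] at h4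
  rw [h4]
  have h5 : ∀ n : ℤ, FourierTransform.fourier (fun x : ℝ => kernel w 1 x) (n : ℝ) *
      (fourier n) (((0 : ℝ)) : UnitAddCircle) =
      FourierTransform.fourier (fun x : ℝ => kernel w 1 x) (n : ℝ) := fun n => by simp
  rw [tsum_congr h5, h3.tsum_eq]
  ring

include hw in
lemma sq_norm_le_of_cone : ‖w‖ ^ 2 ≤ (1 + M ^ 2) * w.re ^ 2 := by
  rw [Complex.sq_norm, Complex.normSq_apply]
  have := pow_le_pow_left₀ (abs_nonneg _) hw 2
  rw [sq_abs] at this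
  linarith

-- The tail is geometric with ratio X = e^{-a}, a = (2π²/3) Re(1/w). The bound X/(1 - X) ≤ 1/a is
-- weak but O(Re w) in the cone, as much as the error term allows.
include hM hw0 hw in
lemma norm_tail_le :
    ‖∑' n : ℕ, (∫ x : ℝ, kernel w (2 * n + 1) x) - ∫ x : ℝ, kernel w 1 x‖ ≤
      Real.exp (-(Real.pi ^ 2 / 6 * (w.re / ‖w‖ ^ 2))) *
        (√(Real.pi / (3 / 2 * w.re)) * (coshBound M)⁻¹) * ((1 + M ^ 2) * w.re) := by
  have hn : 0 < ‖w‖ := norm_pos_iff.mpr (by rintro rfl; simp at hw0)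
  have hpi := Real.pi_pos
  have hs := summable_integral_kernel_odd hM hw0 hw
  rw [hs.tsum_eq_zero_add]
  simp only [Nat.cast_zero, mul_zero, zero_add, add_sub_cancel_left]
  set ρ := w.re / ‖w‖ ^ 2 with hρ
  have hρ0 : 0 < ρ := by positivity
  set X := Real.exp (-(2 / 3 * Real.pi ^ 2 * ρ)) with hX
  have ha : 0 < 2 / 3 * Real.pi ^ 2 * ρ := by positivity
  have hX1 : X < 1 := by rw [hX, Real.exp_lt_one_iff]; linarith
  have hX0 : 0 < X := Real.exp_pos _
  have hgeo := ((hasSum_geometric_of_lt_one hX0.le hX1).mul_left X).mul_left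
    (Real.exp (-(Real.pi ^ 2 / 6 * ρ)) * (√(Real.pi / (3 / 2 * w.re)) * (coshBound M)⁻¹))
  have hbound := tsum_of_norm_bounded hgeo fun n => by
    have := norm_integral_kernel_odd_le hM hw0 hw (n + 1)
    rwa [← hρ, ← hX, pow_succ' X] at this
  refine hbound.trans ?_
  have hκ := coshBound_pos hM
  refine mul_le_mul_of_nonneg_left ?_ (by positivity)
  have e1 := exp_neg_div_le ha
  rw [← hX, div_eq_mul_inv] at e1
  refine e1.trans ?_
  have e2 := sq_norm_le_of_cone hw
  rw [div_le_iff₀ ha, hρ]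
  have e3 : 1 ≤ 2 / 3 * Real.pi ^ 2 := by nlinarith [Real.pi_gt_three]
  have e4 : 1 ≤ (1 + M ^ 2) * w.re * (w.re / ‖w‖ ^ 2) := by
    rw [← mul_div_assoc, le_div_iff₀ (by positivity)]
    linarith
  calc (1 : ℝ) ≤ (2 / 3 * Real.pi ^ 2) * ((1 + M ^ 2) * w.re * (w.re / ‖w‖ ^ 2)) :=
        one_le_mul_of_one_le_of_one_le e3 e4
    _ = _ := by ring

-- By symmetry only the even part of 1/cosh(wx/2 + πi/6) contributes. Its value at 0 is 2/√3 and its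
-- deviation is O(|w|²x²), so the Gaussian integral of the error is O((Re w)^{1/2}), smaller than
-- the main term by a factor of order |w|.
include hM hw0 hw in
lemma norm_main_integral_sub_le :
    ‖(∫ x : ℝ, Complex.exp (-(3 / 2 * w) * x ^ 2) *
        (Complex.cosh (w * x / 2 + ((Real.pi / 6 : ℝ) : ℂ) * Complex.I))⁻¹) -
      2 / (√3 : ℂ) * (Real.pi / (3 / 2 * w)) ^ (1 / 2 : ℂ)‖ ≤
      (3 / coshBound M ^ 2 + 1 / coshBound M + 2) * ((1 + M ^ 2) / 2) * √Real.pi * √w.re := by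
  have hκ := coshBound_pos hM
  set κ := coshBound M with hκd
  set K := 3 / κ ^ 2 + 1 / κ + 2 with hK
  have hK0 : 0 ≤ K := by positivity
  have hpi := Real.pi_pos
  have hb : 0 < (3 / 2 * w).re := by simpa using hw0
  have hcosh : ∀ x : ℝ, κ ≤ ‖Complex.cosh (w * x / 2 + ((Real.pi / 6 : ℝ) : ℂ) * Complex.I)‖ :=
    fun x => coshBound_le_norm_cosh hM hw x (by rw [abs_of_pos (by positivity)])
  have hnormexp : ∀ x : ℝ, ‖Complex.exp (-(3 / 2 * w) * x ^ 2)‖ =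
      Real.exp (-(3 / 2 * w.re) * x ^ 2) := fun x => by
    rw [Complex.norm_exp]
    congr 1
    rw [← Complex.ofReal_pow, Complex.re_mul_ofReal]
    simp
  have hgauss : MeasureTheory.Integrable fun x : ℝ => Complex.exp (-(3 / 2 * w) * x ^ 2) :=
    integrable_cexp_neg_mul_sq hb
  set g : ℝ → ℂ := fun x => Complex.exp (-(3 / 2 * w) * x ^ 2) *
    (Complex.cosh (w * x / 2 + ((Real.pi / 6 : ℝ) : ℂ) * Complex.I))⁻¹ with hg
  have hgint : MeasureTheory.Integrable g := by
    have hint : MeasureTheory.Integrable fun x : ℝ => Real.exp (-(3 / 2 * w.re) * x ^ 2) :=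
      integrable_exp_neg_mul_sq (by positivity)
    refine (hint.mul_const κ⁻¹).mono' ?_ (Eventually.of_forall fun x => ?_)
    · refine Continuous.aestronglyMeasurable ?_
      have : ∀ x : ℝ, Complex.cosh (w * x / 2 + ((Real.pi / 6 : ℝ) : ℂ) * Complex.I) ≠ 0 :=
        fun x => norm_pos_iff.mp (hκ.trans_le (hcosh x))
      fun_prop (disch := exact this)
    · rw [hg, norm_mul, hnormexp, norm_inv]
      gcongr
      exact hcosh x
  have hgneg : ∫ x, g (-x) = ∫ x, g x := MeasureTheory.integral_neg_eq_self g _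
  have hsym : ∫ x, g x = ∫ x, (g x + g (-x)) / 2 := by
    rw [MeasureTheory.integral_div, MeasureTheory.integral_add hgint hgint.comp_neg, hgneg]
    ring
  have havg : MeasureTheory.Integrable fun x => (g x + g (-x)) / 2 :=
    (hgint.add hgint.comp_neg).div_const 2
  rw [hsym, ← integral_gaussian_complex hb, ← MeasureTheory.integral_const_mul,
    ← MeasureTheory.integral_sub havg (hgauss.const_mul _)]
  have hint2 : MeasureTheory.Integrable fun x : ℝ => Real.exp (-w.re * x ^ 2) :=
    integrable_exp_neg_mul_sq hw0
  refine (MeasureTheory.norm_integral_le_of_norm_le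
    (hint2.const_mul (K * ((1 + M ^ 2) / 2) * w.re)) (Eventually.of_forall fun x => ?_)).trans_eq ?_
  · have e1 : (g x + g (-x)) / 2 - 2 / (√3 : ℂ) * Complex.exp (-(3 / 2 * w) * x ^ 2) =
        Complex.exp (-(3 / 2 * w) * x ^ 2) *
          (((Complex.cosh (w * x / 2 + ((Real.pi / 6 : ℝ) : ℂ) * Complex.I))⁻¹ +
          (Complex.cosh (-(w * x / 2) + ((Real.pi / 6 : ℝ) : ℂ) * Complex.I))⁻¹) / 2 -
            2 / (√3 : ℂ)) := by
      simp only [hg, Complex.ofReal_neg, neg_sq, mul_neg, neg_div]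
      ring
    have e2 : κ ≤ ‖Complex.cosh (-(w * x / 2) + ((Real.pi / 6 : ℝ) : ℂ) * Complex.I)‖ := by
      have := hcosh (-x)
      rwa [Complex.ofReal_neg, mul_neg, neg_div] at this
    rw [e1, norm_mul, hnormexp]
    have e3 := norm_even_part_sub_le hκ (hcosh x) e2
    have e4 : ‖w * x / 2‖ ^ 2 ≤ (1 + M ^ 2) * w.re ^ 2 * x ^ 2 / 4 := by
      rw [norm_div, norm_mul, Complex.norm_real, Complex.norm_ofNat, div_pow, mul_pow,
        Real.norm_eq_abs, sq_abs]
      have := sq_norm_le_of_cone hw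
      norm_num
      gcongr
    have e5 : Real.exp (-(3 / 2 * w.re) * x ^ 2) * (w.re * x ^ 2 / 2) ≤
        Real.exp (-w.re * x ^ 2) := by
      have h1 : w.re * x ^ 2 / 2 ≤ Real.exp (w.re * x ^ 2 / 2) := by
        have := Real.add_one_le_exp (w.re * x ^ 2 / 2)
        linarith
      calc _ ≤ Real.exp (-(3 / 2 * w.re) * x ^ 2) * Real.exp (w.re * x ^ 2 / 2) := by gcongr
        _ = _ := by rw [← Real.exp_add]; congr 1; ring
    calc _ ≤ Real.exp (-(3 / 2 * w.re) * x ^ 2) * (K * ((1 + M ^ 2) * w.re ^ 2 * x ^ 2 / 4)) := by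
          gcongr
          exact e3.trans (by gcongr)
      _ = K * ((1 + M ^ 2) / 2) * w.re *
          (Real.exp (-(3 / 2 * w.re) * x ^ 2) * (w.re * x ^ 2 / 2)) := by ring
      _ ≤ _ := by gcongr
  · rw [MeasureTheory.integral_const_mul, integral_gaussian, Real.sqrt_div' _ hw0.le]
    have := Real.sqrt_pos.mpr hw0
    have h2 : w.re = √w.re * √w.re := (Real.mul_self_sqrt hw0.le).symm
    rw [mul_assoc, mul_assoc (K * _)]
    congr 1
    field_simp
    rw [Real.sq_sqrt hw0.le]

end

/-- The Appell sum is asymptotic to `(4 / √3) (2π / (3w))^{1/2} exp(-π² / (6w))`. -/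
lemma exists_tsum_kernel_eq {M : ℝ} (hM : 0 < M) : ∃ C : ℝ, 0 ≤ C ∧ ∀ w : ℂ, 0 < w.re →
    |w.im| ≤ M * w.re → ∃ e : ℂ, ‖e‖ ≤ C * √w.re ∧ ∑' n : ℤ, kernel w 1 n =
      Complex.exp (-((Real.pi ^ 2 / 6 : ℝ) / w)) *
        (4 / (√3 : ℂ) * (Real.pi / (3 / 2 * w)) ^ (1 / 2 : ℂ) + e) := by
  have hκ := coshBound_pos hM
  have hpi := Real.pi_pos
  refine ⟨2 * ((3 / coshBound M ^ 2 + 1 / coshBound M + 2) * ((1 + M ^ 2) / 2) * √Real.pi) +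
    2 * (√(Real.pi / (3 / 2)) * (coshBound M)⁻¹ * (1 + M ^ 2)), by positivity,
    fun w hw0 hw => ?_⟩
  have hn : w ≠ 0 := by rintro rfl; simp at hw0
  set E := Complex.exp (-((Real.pi ^ 2 / 6 : ℝ) / w)) with hE
  have hE0 : E ≠ 0 := Complex.exp_ne_zero _
  set J := ∫ x : ℝ, Complex.exp (-(3 / 2 * w) * x ^ 2) *
    (Complex.cosh (w * x / 2 + ((Real.pi / 6 : ℝ) : ℂ) * Complex.I))⁻¹ with hJ
  have hI : ∫ x : ℝ, kernel w 1 x = E * J := by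
    rw [integral_kernel_shift hM hw0 hw]
    simp only [kernel_shift hn]
    rw [MeasureTheory.integral_const_mul, hE, hJ]
    congr 2
    · push_cast; ring_nf
    · ext x
      push_cast; ring_nf
  set T := ∑' n : ℕ, (∫ x : ℝ, kernel w (2 * n + 1) x) - ∫ x : ℝ, kernel w 1 x with hT
  refine ⟨2 * (J - 2 / (√3 : ℂ) * (Real.pi / (3 / 2 * w)) ^ (1 / 2 : ℂ)) + 2 * (E⁻¹ * T), ?_, ?_⟩
  · have h1 := norm_main_integral_sub_le hM hw0 hw
    have h2 := norm_tail_le hM hw0 hw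
    rw [← hT, ← norm_exp_neg_div, ← hE] at h2
    have h3 : ‖E⁻¹ * T‖ ≤ √(Real.pi / (3 / 2)) * (coshBound M)⁻¹ * (1 + M ^ 2) * √w.re := by
      rw [norm_mul, norm_inv, inv_mul_le_iff₀ (norm_pos_iff.mpr hE0)]
      refine h2.trans_eq ?_
      rw [← div_div, Real.sqrt_div' _ hw0.le]
      have := Real.sqrt_pos.mpr hw0
      field_simp
      rw [Real.sq_sqrt hw0.le]
    refine (norm_add_le _ _).trans ?_
    rw [norm_mul, norm_mul, Complex.norm_ofNat, add_mul]
    refine add_le_add ?_ ?_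
    · rw [mul_assoc]; gcongr
    · rw [mul_assoc]; gcongr
  · rw [tsum_kernel_eq hM hw0 hw]
    have : ∑' n : ℕ, ∫ x : ℝ, kernel w (2 * n + 1) x = T + E * J := by rw [hT, hI]; ring
    rw [this]
    have h2 : E * (E⁻¹ * T) = T := mul_inv_cancel_left₀ hE0 T
    linear_combination (-2) * h2

end OddEvenOverpartition

namespace OddEvenOverpartition

/-! ### The infinite products near the dominant singularity -/

lemma csqrt_sq {z : ℂ} (hz : z ≠ 0) : Complex.sqrt z ^ 2 = z := by
  rw [Complex.sqrt, Complex.cpow_def_of_ne_zero hz, ← Complex.exp_nat_mul]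
  push_cast
  rw [show 2 * (Complex.log z * 2⁻¹) = Complex.log z by ring, Complex.exp_log hz]

lemma csqrt_ne_zero {z : ℂ} (hz : z ≠ 0) : Complex.sqrt z ≠ 0 := by
  intro h
  have := csqrt_sq hz
  rw [h] at this
  exact hz (by simpa using this.symm)

lemma csqrt_ofReal_mul {r : ℝ} (hr : 0 < r) {z : ℂ} (hz : z ≠ 0) :
    Complex.sqrt (r * z) = √r * Complex.sqrt z := by
  have hr' : (r : ℂ) ≠ 0 := by exact_mod_cast hr.ne'
  have hs : ((√r : ℝ) : ℂ) = Complex.exp ((Real.log r : ℂ) * 2⁻¹) := by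
    rw [Real.sqrt_eq_rpow, Real.rpow_def_of_pos hr]
    push_cast; ring_nf
  rw [Complex.sqrt, Complex.sqrt, Complex.cpow_def_of_ne_zero (mul_ne_zero hr' hz),
    Complex.cpow_def_of_ne_zero hz, Complex.log_ofReal_mul hr hz, add_mul, Complex.exp_add, hs]

/-- For z in the upper half-plane, arg i - arg z lies in (-π/2, π/2), so the principal logarithm is
additive here. -/
lemma csqrt_I_div {z : ℂ} (hz : 0 < z.im) :
    Complex.sqrt (Complex.I / z) = Complex.sqrt Complex.I / Complex.sqrt z := by
  have hz0 : z ≠ 0 := by rintro rfl; simp at hz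
  have h0 : 0 < z.arg := by
    refine lt_of_le_of_ne (Complex.arg_nonneg_iff.mpr hz.le) fun h => ?_
    have := (Complex.arg_eq_zero_iff.mp h.symm).2
    linarith
  have hpi : z.arg < Real.pi := Complex.arg_lt_pi_iff.mpr (Or.inr hz.ne')
  have hlog : Complex.log (Complex.I / z) = Complex.log Complex.I - Complex.log z := by
    rw [div_eq_mul_inv, Complex.log_mul Complex.I_ne_zero (inv_ne_zero hz0), Complex.log_inv _ hpi.ne,
      sub_eq_add_neg]
    rw [Complex.arg_inv, if_neg hpi.ne, Complex.arg_I]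
    constructor <;> linarith [Real.pi_pos]
  rw [Complex.sqrt, Complex.sqrt, Complex.sqrt,
    Complex.cpow_def_of_ne_zero (div_ne_zero Complex.I_ne_zero hz0),
    Complex.cpow_def_of_ne_zero Complex.I_ne_zero, Complex.cpow_def_of_ne_zero hz0, hlog,
    ← Complex.exp_sub]
  ring_nf

lemma norm_nome_lt_one {τ : ℂ} (hτ : 0 < τ.im) : ‖nome τ‖ < 1 := by
  rw [nome, Complex.norm_exp, Real.exp_lt_one_iff]
  have := Real.pi_pos
  simp
  positivity

lemma eta_eq (τ : ℂ) : ModularForm.eta τ =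
    Complex.exp (2 * Real.pi * Complex.I * τ / 24) * qPochInf (nome τ) (nome τ) := by
  rw [ModularForm.eta, qPochInf, Function.Periodic.qParam]
  congr 1
  refine tprod_congr fun n => ?_
  rw [ModularForm.eta_q_eq_pow, pow_succ', nome]

lemma im_neg_one_div (τ : ℂ) : (-1 / τ).im = τ.im / ‖τ‖ ^ 2 := by
  rw [Complex.div_im, Complex.sq_norm]
  simp
  ring

lemma qPochInf_transformation {τ : ℂ} (hτ : 0 < τ.im) :
    qPochInf (nome τ) (nome τ) = Complex.sqrt Complex.I / Complex.sqrt τ *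
      Complex.exp (2 * Real.pi * Complex.I * (-1 / τ - τ) / 24) *
        qPochInf (nome (-1 / τ)) (nome (-1 / τ)) := by
  have hτ0 : τ ≠ 0 := by rintro rfl; simp at hτ
  have h := ModularForm.eta_comp_eq_csqrt_I_inv hτ
  simp only [Function.comp, Pi.smul_apply, Pi.mul_apply, smul_eq_mul] at h
  rw [eta_eq, eta_eq] at h
  have n1 := csqrt_ne_zero hτ0
  have n2 := csqrt_ne_zero Complex.I_ne_zero
  have n3 := Complex.exp_ne_zero (2 * Real.pi * Complex.I * τ / 24)
  rw [show 2 * Real.pi * Complex.I * (-1 / τ - τ) / 24 =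
    2 * Real.pi * Complex.I * (-1 / τ) / 24 - 2 * Real.pi * Complex.I * τ / 24 by ring,
    Complex.exp_sub]
  rw [mul_div_assoc', div_mul_eq_mul_div, mul_assoc, h]
  field_simp

lemma norm_qPochInf_sub_one_le {q : ℂ} (hq : ‖q‖ ≤ 1 / 4) : ‖qPochInf q q - 1‖ ≤ 3 * ‖q‖ := by
  have hq1 : ‖q‖ < 1 := by linarith
  refine le_of_tendsto ((tendsto_qPoch q hq1).sub_const 1).norm (Eventually.of_forall fun n => ?_)
  have h := Finset.norm_prod_one_add_sub_one_le (range n) fun k => -(q * q ^ k)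
  simp only [← sub_eq_add_neg, norm_neg, norm_mul, norm_pow, ← mul_sum] at h
  have h1 : ‖q‖ * ∑ k ∈ range n, ‖q‖ ^ k ≤ 4 / 3 * ‖q‖ := by
    rw [mul_comm]
    gcongr
    refine (sum_pow_le_inv (norm_nonneg q) hq1 n).trans ?_
    rw [inv_le_comm₀ (by linarith) (by norm_num)]
    linarith
  have h2 : Real.exp (4 / 3 * ‖q‖) - 1 ≤ 3 * ‖q‖ := by
    have := Real.abs_exp_sub_one_le (x := 4 / 3 * ‖q‖)
      (by rw [abs_of_nonneg (by positivity)]; linarith)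
    rw [abs_of_nonneg (by positivity : 0 ≤ 4 / 3 * ‖q‖)] at this
    have := le_abs_self (Real.exp (4 / 3 * ‖q‖) - 1)
    have := norm_nonneg q
    linarith
  have h3 := Real.exp_le_exp.mpr h1
  rw [qPoch]
  linarith

lemma norm_div_sq_sub_one_le {P Q : ℂ} {a : ℝ} (ha : a ≤ 1 / 12) (hP : ‖P - 1‖ ≤ 3 * a)
    (hQ : ‖Q - 1‖ ≤ 3 * a) : ‖P / Q ^ 2 - 1‖ ≤ 20 * a := by
  have ha0 : 0 ≤ a := by linarith [norm_nonneg (P - 1)]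
  have h1 : 3 / 4 ≤ ‖Q‖ := by
    have := norm_sub_norm_le (1 : ℂ) Q
    rw [norm_one, norm_sub_rev] at this
    linarith
  have hQ0 : Q ≠ 0 := norm_pos_iff.mp (by linarith)
  have h2 : P / Q ^ 2 - 1 = ((P - 1) - (Q - 1) * ((Q - 1) + 2)) / Q ^ 2 := by
    field_simp
    ring
  have h3 : ‖(Q - 1) + 2‖ ≤ 9 / 4 := by
    refine (norm_add_le _ _).trans ?_
    rw [Complex.norm_ofNat]
    linarith
  have h4 : ‖(P - 1) - (Q - 1) * ((Q - 1) + 2)‖ ≤ 3 * a + 3 * a * (9 / 4) := by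
    refine (norm_sub_le _ _).trans ?_
    rw [norm_mul]
    gcongr
  rw [h2, norm_div, norm_pow, div_le_iff₀ (by positivity)]
  have h5 : (3 / 4 : ℝ) ^ 2 ≤ ‖Q‖ ^ 2 := pow_le_pow_left₀ (by norm_num) h1 2
  nlinarith

/-! ### The generating function near the dominant singularity -/

lemma appell_term_eq {τ : ℂ} (hτ : 0 < τ.im) (r : ℤ) :
    (-1) ^ r.natAbs * nome τ ^ (r.natAbs ^ 2) *
      (nome τ ^ ((r.natAbs + 1).choose 2) * (2 / (1 + nome τ ^ r.natAbs))) =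
      kernel (-(2 * Real.pi * Complex.I * τ)) 1 r := by
  set w := -(2 * Real.pi * Complex.I * τ) with hw
  have hq : nome τ = Complex.exp (-w) := by rw [nome, hw, neg_neg]
  -- At integers the phase e^{πir} is even in r, as is the rest of the kernel.
  have hnat : kernel w 1 r = kernel w 1 (r.natAbs : ℤ) := by
    rcases Int.natAbs_eq r with h | h
    · rw [← h]
    · have h' : (r.natAbs : ℤ) = -r := by lia
      rw [h', kernel, kernel, Int.cast_neg, show w * -(r : ℂ) / 2 = -(w * r / 2) by ring,
        Complex.cosh_neg]
      congr 1
      rw [Complex.exp_eq_exp_iff_exists_int]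
      exact ⟨r, by push_cast; ring⟩
  rw [hnat]
  generalize r.natAbs = s
  have hne : 1 + nome τ ^ s ≠ 0 := by
    rcases s with _ | s
    · norm_num
    · have h1 := norm_nome_lt_one hτ
      have := one_sub_mul_pow_ne_zero (a := -nome τ) (by simpa using h1) h1 s
      rwa [neg_mul, sub_neg_eq_add, ← pow_succ'] at this
  have hcosh : Complex.cosh (w * s / 2) = Complex.exp (w * s / 2) * (1 + nome τ ^ s) / 2 := by
    rw [Complex.cosh, mul_add, hq, ← Complex.exp_nat_mul, ← Complex.exp_add]
    ring_nf
  have hsign : (-1 : ℂ) ^ s = Complex.exp (Real.pi * s * Complex.I) := by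
    rw [← Complex.exp_pi_mul_I, ← Complex.exp_nat_mul]
    ring_nf
  have hc : (((s + 1).choose 2 : ℕ) : ℂ) = s * (s + 1) / 2 := by
    rw [Nat.cast_choose_two]; push_cast; ring
  have hexp : Complex.exp (-(3 / 2) * w * s ^ 2 + Real.pi * s * Complex.I) =
      Complex.exp (w * s / 2) * ((-1) ^ s * nome τ ^ (s ^ 2) * nome τ ^ ((s + 1).choose 2)) := by
    rw [hsign, hq, ← Complex.exp_nat_mul, ← Complex.exp_nat_mul, hc, ← Complex.exp_add,
      ← Complex.exp_add, ← Complex.exp_add]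
    congr 1
    push_cast
    ring
  have hne2 := Complex.exp_ne_zero (w * s / 2)
  rw [kernel, Int.cast_natCast, hcosh, Complex.ofReal_one, mul_one, hexp]
  field_simp

lemma genFun_nome_eq {τ : ℂ} (hτ : 0 < τ.im) :
    genFun (nome τ) = qPochInf (nome (2 * τ)) (nome (2 * τ)) / qPochInf (nome τ) (nome τ) ^ 2 *
      ∑' r : ℤ, kernel (-(2 * Real.pi * Complex.I * τ)) 1 r := by
  have hq := norm_nome_lt_one hτ
  have hq0 : nome τ ≠ 0 := Complex.exp_ne_zero _
  have h2 : nome (2 * τ) = nome τ ^ 2 := by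
    rw [nome, nome, ← Complex.exp_nat_mul]; push_cast; ring_nf
  have hne := qPochInf_ne_zero hq hq
  rw [genFun_eq hq, h2, ← qPochInf_neg_mul hq, ← tsum_congr (appell_term_eq hτ)]
  refine (tsum_eq_appell hq hq0).trans ?_
  congr 1
  field_simp

/-- This is the inversion of η(2τ)/η(τ)², in which the powers q^{1/24} cancel. The exponents of -1/τ
combine to πi/(8τ). -/
lemma qPochInf_quotient_eq {τ : ℂ} (hτ : 0 < τ.im) :
    qPochInf (nome (2 * τ)) (nome (2 * τ)) / qPochInf (nome τ) (nome τ) ^ 2 =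
      Complex.sqrt τ / (√2 * Complex.sqrt Complex.I) *
        Complex.exp (Real.pi * Complex.I / (8 * τ)) *
        (qPochInf (nome (-1 / (2 * τ))) (nome (-1 / (2 * τ))) /
          qPochInf (nome (-1 / τ)) (nome (-1 / τ)) ^ 2) := by
  have hτ0 : τ ≠ 0 := by rintro rfl; simp at hτ
  have hτ2 : 0 < (2 * τ).im := by simpa using hτ
  have hτ' : 0 < (-1 / τ).im := by
    rw [im_neg_one_div]
    have := norm_pos_iff.mpr hτ0
    positivity
  have hne := qPochInf_ne_zero (norm_nome_lt_one hτ') (norm_nome_lt_one hτ')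
  rw [qPochInf_transformation hτ, qPochInf_transformation hτ2]
  have hs2 : Complex.sqrt (2 * τ) = √2 * Complex.sqrt τ := by
    have := csqrt_ofReal_mul (r := 2) two_pos hτ0
    simpa using this
  have n1 := csqrt_ne_zero hτ0
  have n2 := csqrt_ne_zero Complex.I_ne_zero
  have n3 : ((√2 : ℝ) : ℂ) ≠ 0 := by
    rw [Complex.ofReal_ne_zero]; positivity
  have n4 := Complex.exp_ne_zero (2 * Real.pi * Complex.I * (-1 / τ - τ) / 24)
  have hexp : Complex.exp (2 * Real.pi * Complex.I * (-1 / (2 * τ) - 2 * τ) / 24) =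
      Complex.exp (Real.pi * Complex.I / (8 * τ)) *
        Complex.exp (2 * Real.pi * Complex.I * (-1 / τ - τ) / 24) ^ 2 := by
    rw [← Complex.exp_nat_mul, ← Complex.exp_add]
    congr 1
    push_cast
    field_simp
    ring
  rw [hexp, hs2]
  field_simp

lemma norm_nome_eq (τ : ℂ) : ‖nome τ‖ = Real.exp (-(2 * Real.pi * τ.im)) := by
  rw [nome, Complex.norm_exp]
  simp

end OddEvenOverpartition

namespace OddEvenOverpartition

/-! ### The major arc -/

lemma cpow_pi_div_eq {τ : ℂ} (hτ : 0 < τ.im) :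
    ((Real.pi : ℂ) / (3 / 2 * -(2 * Real.pi * Complex.I * τ))) ^ (1 / 2 : ℂ) =
      (√3 : ℂ)⁻¹ * (Complex.sqrt Complex.I / Complex.sqrt τ) := by
  have hτ0 : τ ≠ 0 := by rintro rfl; simp at hτ
  have hpi : (Real.pi : ℂ) ≠ 0 := by exact_mod_cast Real.pi_ne_zero
  have h : (Real.pi : ℂ) / (3 / 2 * -(2 * Real.pi * Complex.I * τ)) =
      ((1 / 3 : ℝ) : ℂ) * (Complex.I / τ) := by
    have hI := Complex.I_ne_zero
    push_cast
    field_simp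
    rw [Complex.I_sq]
  have h3 : √(1 / 3 : ℝ) = (√3)⁻¹ := by rw [one_div, Real.sqrt_inv]
  rw [h, ← csqrt_I_div hτ, ← Complex.ofReal_inv, ← h3,
    ← csqrt_ofReal_mul (by norm_num) (div_ne_zero Complex.I_ne_zero hτ0), Complex.sqrt,
    one_div (2 : ℂ)]

lemma norm_csqrt {z : ℂ} (hz : z ≠ 0) : ‖Complex.sqrt z‖ = √‖z‖ := by
  rw [eq_comm, Real.sqrt_eq_iff_mul_self_eq (norm_nonneg _) (norm_nonneg _), ← sq, ← norm_pow,
    csqrt_sq hz]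

lemma genFun_nome_eq_main_term {τ e : ℂ} (hτ : 0 < τ.im)
    (h : ∑' r : ℤ, kernel (-(2 * Real.pi * Complex.I * τ)) 1 r =
      Complex.exp (-((Real.pi ^ 2 / 6 : ℝ) / -(2 * Real.pi * Complex.I * τ))) *
        (4 / (√3 : ℂ) *
          ((Real.pi : ℂ) / (3 / 2 * -(2 * Real.pi * Complex.I * τ))) ^ (1 / 2 : ℂ) + e)) :
    genFun (nome τ) =
      qPochInf (nome (-1 / (2 * τ))) (nome (-1 / (2 * τ))) /
          qPochInf (nome (-1 / τ)) (nome (-1 / τ)) ^ 2 *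
        (Complex.exp (Real.pi * Complex.I / (24 * τ)) *
          (2 * (√2 : ℂ) / 3 + Complex.sqrt τ / (√2 * Complex.sqrt Complex.I) * e)) := by
  have hτ0 : τ ≠ 0 := by rintro rfl; simp at hτ
  have n1 := csqrt_ne_zero hτ0
  have n2 := csqrt_ne_zero Complex.I_ne_zero
  have n3 : ((√2 : ℝ) : ℂ) ≠ 0 := by rw [Complex.ofReal_ne_zero]; positivity
  have n4 : ((√3 : ℝ) : ℂ) ≠ 0 := by rw [Complex.ofReal_ne_zero]; positivity
  have hpi : (Real.pi : ℂ) ≠ 0 := by exact_mod_cast Real.pi_ne_zero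
  have hexp : Complex.exp (Real.pi * Complex.I / (24 * τ)) =
      Complex.exp (Real.pi * Complex.I / (8 * τ)) *
        Complex.exp (-((Real.pi ^ 2 / 6 : ℝ) / -(2 * Real.pi * Complex.I * τ))) := by
    rw [← Complex.exp_add]
    congr 1
    have hI := Complex.I_ne_zero
    push_cast
    field_simp
    rw [Complex.I_sq]
    ring
  have hmain : Complex.sqrt τ / (√2 * Complex.sqrt Complex.I) * (4 / (√3 : ℂ) *
      ((√3 : ℂ)⁻¹ * (Complex.sqrt Complex.I / Complex.sqrt τ))) = 2 * (√2 : ℂ) / 3 := by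
    have h2 : ((√2 : ℝ) : ℂ) ^ 2 = 2 := by
      exact_mod_cast Real.sq_sqrt (show (0 : ℝ) ≤ 2 by norm_num)
    have h3 : ((√3 : ℝ) : ℂ) ^ 2 = 3 := by
      exact_mod_cast Real.sq_sqrt (show (0 : ℝ) ≤ 3 by norm_num)
    field_simp
    rw [h2, h3]
    ring
  rw [genFun_nome_eq hτ, qPochInf_quotient_eq hτ, h, cpow_pi_div_eq hτ, hexp, ← hmain]
  ring

lemma norm_exp_pi_I_div (τ : ℂ) :
    ‖Complex.exp (Real.pi * Complex.I / (24 * τ))‖ =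
      Real.exp (Real.pi / 24 * (-1 / τ).im) := by
  rw [Complex.norm_exp, show Real.pi * Complex.I / (24 * τ) =
    -(((Real.pi / 24 : ℝ) : ℂ) * ((-1 / τ) * Complex.I)) by push_cast; ring, Complex.neg_re,
    Complex.re_ofReal_mul, Complex.mul_I_re, mul_neg, neg_neg]

lemma norm_sub_le_of_perturbation {R X c e : ℂ} {α β y : ℝ} (hy : 0 ≤ y) (hy1 : y ≤ 1)
    (hα : 0 ≤ α) (hβ : 0 ≤ β) (hR : ‖R - 1‖ ≤ α * y) (he : ‖e‖ ≤ β * y) :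
    ‖R * (X * (c + e)) - c * X‖ ≤ (α * (‖c‖ + β) + β) * (y * ‖X‖) := by
  have hey : ‖e‖ ≤ β := he.trans (mul_le_of_le_one_right hβ hy1)
  have h : R * (X * (c + e)) - c * X = X * ((R - 1) * (c + e) + e) := by ring
  rw [h, norm_mul]
  have h2 : ‖(R - 1) * (c + e) + e‖ ≤ α * y * (‖c‖ + β) + β * y := by
    refine (norm_add_le _ _).trans (add_le_add ?_ he)
    rw [norm_mul]
    gcongr
    exact (norm_add_le _ _).trans (by gcongr)
  calc ‖X‖ * ‖(R - 1) * (c + e) + e‖ ≤ ‖X‖ * (α * y * (‖c‖ + β) + β * y) := by gcongr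
    _ = _ := by ring

/-- The first factor of the generating function is close to `1` on the major arc. -/
lemma norm_qPochInf_quotient_sub_one_le {K : ℝ} {τ : ℂ} (hτ : 0 < τ.im)
    (hn : ‖τ‖ ^ 2 ≤ K * τ.im ^ 2) (hy : K * τ.im ≤ 1 / 12) :
    ‖qPochInf (nome (-1 / (2 * τ))) (nome (-1 / (2 * τ))) /
      qPochInf (nome (-1 / τ)) (nome (-1 / τ)) ^ 2 - 1‖ ≤ 20 * K * τ.im := by
  have hτ0 : τ ≠ 0 := by rintro rfl; simp at hτ
  have hpos := norm_pos_iff.mpr hτ0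
  have hs : Real.pi * (τ.im / ‖τ‖ ^ 2) = 2 * Real.pi * (-1 / (2 * τ)).im := by
    rw [im_neg_one_div, norm_mul, Complex.norm_ofNat]
    simp
    ring
  have hs0 : 0 < Real.pi * (τ.im / ‖τ‖ ^ 2) := by have := Real.pi_pos; positivity
  have ha : ‖nome (-1 / (2 * τ))‖ ≤ K * τ.im := by
    rw [norm_nome_eq, ← hs]
    have h1 : Real.exp (-(Real.pi * (τ.im / ‖τ‖ ^ 2))) ≤ (Real.pi * (τ.im / ‖τ‖ ^ 2))⁻¹ := by
      rw [Real.exp_neg]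
      gcongr
      linarith [Real.add_one_le_exp (Real.pi * (τ.im / ‖τ‖ ^ 2))]
    refine h1.trans ?_
    rw [mul_div_assoc', inv_div, div_le_iff₀ (by positivity)]
    nlinarith [Real.pi_gt_three, sq_nonneg ‖τ‖]
  have hb : ‖nome (-1 / τ)‖ ≤ K * τ.im := by
    refine le_trans ?_ ha
    rw [norm_nome_eq, norm_nome_eq, ← hs, im_neg_one_div]
    refine Real.exp_le_exp.mpr (neg_le_neg ?_)
    rw [mul_assoc, two_mul]
    linarith
  have hP := norm_qPochInf_sub_one_le (ha.trans (hy.trans (by norm_num)))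
  have hQ := norm_qPochInf_sub_one_le (hb.trans (hy.trans (by norm_num)))
  rw [mul_assoc]
  exact norm_div_sq_sub_one_le hy (hP.trans (by gcongr)) (hQ.trans (by gcongr))

lemma norm_genFun_major_arc {M : ℝ} (hM : 0 < M) :
    ∃ C : ℝ, ∃ y₀ : ℝ, 0 < y₀ ∧ ∀ (x y : ℝ) (τ : ℂ), τ = x + y * Complex.I →
      0 < y → y < y₀ → |x| ≤ M * y →
      ‖genFun (nome τ) -
          2 * (Real.sqrt 2 : ℂ) / 3 * Complex.exp (Real.pi * Complex.I / (24 * τ))‖ ≤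
        C * (y * Real.exp (Real.pi / 24 * (-1 / τ).im)) := by
  obtain ⟨C, hC, h⟩ := exists_tsum_kernel_eq hM
  set K := 1 + M ^ 2 with hK
  have hK0 : 0 < K := by positivity
  refine ⟨20 * K * (‖2 * (Real.sqrt 2 : ℂ) / 3‖ + C * √(K * Real.pi)) + C * √(K * Real.pi), min 1 (1 / (12 * K)),
    by positivity, fun x y τ hτ hy hy0 hx => ?_⟩
  have hre : τ.re = x := by simp [hτ]
  have him : τ.im = y := by simp [hτ]
  have hτ0 : τ ≠ 0 := by rintro rfl; simp at him; linarith
  have hτi : 0 < τ.im := him ▸ hy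
  have hy1 : y < 1 := hy0.trans_le (min_le_left _ _)
  have hy2 : K * y ≤ 1 / 12 := by
    have := hy0.trans_le (min_le_right _ _)
    rw [lt_div_iff₀ (by positivity)] at this
    linarith
  have hnorm : ‖τ‖ ^ 2 ≤ K * y ^ 2 := by
    have : x ^ 2 ≤ (M * y) ^ 2 := sq_le_sq' (by linarith [neg_abs_le x]) (by linarith [le_abs_self x])
    rw [Complex.sq_norm, Complex.normSq_apply, hre, him]
    rw [hK]
    linarith
  have hnorm' : ‖τ‖ ≤ K * y := by
    refine le_of_sq_le_sq (hnorm.trans ?_) (by positivity)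
    have : 1 ≤ K := by rw [hK]; linarith [sq_nonneg M]
    rw [mul_pow]
    gcongr
    exact le_self_pow₀ this two_ne_zero
  have hwre : (-(2 * Real.pi * Complex.I * τ)).re = 2 * Real.pi * y := by simp [him]
  have hwim : (-(2 * Real.pi * Complex.I * τ)).im = -(2 * Real.pi * x) := by simp [hre]
  have hpi := Real.pi_pos
  obtain ⟨e, he, hsum⟩ := h (-(2 * Real.pi * Complex.I * τ)) (by rw [hwre]; positivity) (by
    rw [hwre, hwim, abs_neg, abs_mul, abs_of_pos (by positivity : 0 < 2 * Real.pi)]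
    calc 2 * Real.pi * |x| ≤ 2 * Real.pi * (M * y) := by gcongr
      _ = _ := by ring)
  have hR := norm_qPochInf_quotient_sub_one_le hτi (by rwa [him]) (by rwa [him])
  rw [him] at hR
  rw [genFun_nome_eq_main_term hτi hsum, ← norm_exp_pi_I_div]
  refine norm_sub_le_of_perturbation hy.le hy1.le (by positivity) (by positivity) hR ?_
  rw [norm_mul, norm_div, norm_mul, norm_csqrt hτ0, norm_csqrt Complex.I_ne_zero, Complex.norm_I,
    Real.sqrt_one, mul_one, Complex.norm_of_nonneg (Real.sqrt_nonneg 2)]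
  rw [hwre, mul_assoc, Real.sqrt_mul zero_le_two] at he
  have h2 : 0 < √(2 : ℝ) := by positivity
  -- The prefactor √τ and the error bound √(Re w) each contribute √y, which gives the error O(y).
  calc √‖τ‖ / √2 * ‖e‖ ≤ √(K * y) / √2 * (C * (√2 * √(Real.pi * y))) := by gcongr
    _ = C * (√(K * y) * √(Real.pi * y)) := by field_simp
    _ = C * √(K * Real.pi) * y := by
      rw [← Real.sqrt_mul (by positivity), show K * y * (Real.pi * y) = K * Real.pi * y ^ 2 by ring,
        Real.sqrt_mul (by positivity), Real.sqrt_sq hy.le, mul_assoc]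

end OddEvenOverpartition

theorem mainTheorem5 :
    -- the power series defining the generating function converges on the open unit disc
    (∀ q : ℂ, ‖q‖ < 1 →
      Summable (fun n : ℕ => (OddEvenOverpartition.count n : ℂ) * q ^ n)) ∧
    ∀ M : ℝ, 0 < M →
      -- (i)
      (∃ C : ℝ, ∃ y₀ : ℝ, 0 < y₀ ∧ ∀ (x y : ℝ) (τ : ℂ), τ = x + y * Complex.I →
        0 < y → y < y₀ → |x| ≤ M * y →
        ‖OddEvenOverpartition.genFun (OddEvenOverpartition.nome τ) -
            2 * (Real.sqrt 2 : ℂ) / 3 * Complex.exp (Real.pi * Complex.I / (24 * τ))‖ ≤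
          C * (y * Real.exp (Real.pi / 24 * (-1 / τ).im))) ∧
      -- (ii)
      (∃ C : ℝ, ∃ y₀ : ℝ, 0 < y₀ ∧ ∀ (x y : ℝ) (τ : ℂ), τ = x + y * Complex.I →
        0 < y → y < y₀ → M * y < |x| → |x| ≤ 1 / 2 →
        ‖OddEvenOverpartition.genFun (OddEvenOverpartition.nome τ)‖ ≤
          C * (1 / (y * Real.sqrt 2) * Real.exp (1 / y *
            (Real.pi / 8 - 1 / Real.pi * (1 - 1 / Real.sqrt (1 + M ^ 2)))))) :=
  ⟨fun _ hq => (OddEvenOverpartition.hasSum_count hq).summable, fun _ hM =>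
    ⟨OddEvenOverpartition.norm_genFun_major_arc hM, OddEvenOverpartition.norm_genFun_minor_arc hM⟩⟩
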